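/- **Setting.** Let $n\ge 1$, let $\mathcal H_C,\mathcal H_A$ be complex Hilbert spaces and $|\psi\rangle\in\mathcal H_C\otimes\mathcal H_A$ a unit vector. For each $\mathbf z\in\{1,2,3\}^n$ Charlie has a projective measurement $\{\Pi^C_{\mathbf c|\mathbf z}\}$, and for each $\mathbf x\in\{1,\dots,6\}^n$ Alice has a projective measurement $\{\Pi^A_{\mathbf a|\mathbf x}\}$, with outcomes $\mathbf c,\mathbf a\in\{\pm1\}^n$. Put $\mathsf O_{i|\mathbf z}=\sum_{c_i=+1}\Pi^C_{\mathbf c|\mathbf z}-\sum_{c_i=-1}\Pi^C_{\mathbf c|\mathbf z}$ and let $\mathsf Z_i,\mathsf X_i,\mathsf Y_i$ be the averages $3^{-(n-1)}\sum_{\mathbf z:z_i=r}\mathsf O_{i|\mathbf z}$ for $r=1,2,3$. Define $\mathsf Q_{i|\mathbf x}$ from $\Pi^A_{\mathbf a|\mathbf x}$ in the same way, and let $\mathsf D_{zx,i},\mathsf E_{zx,i},\mathsf D_{zy,i},\mathsf E_{zy,i},\mathsf D_{xy,i},\mathsf E_{xy,i}$ be the averages $6^{-(n-1)}\sum_{\mathbf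 x:x_i=r}\mathsf Q_{i|\mathbf x}$ for $r=1,\dots,6$. Let $$\mathcal B_i=\mathsf Z_i(\mathsf D_{zx,i}+\mathsf E_{zx,i})+\mathsf X_i(\mathsf D_{zx,i}-\mathsf E_{zx,i})+\mathsf Z_i(\mathsf D_{zy,i}+\mathsf E_{zy,i})-\mathsf Y_i(\mathsf D_{zy,i}-\mathsf E_{zy,i})+\mathsf X_i(\mathsf D_{xy,i}+\mathsf E_{xy,i})-\mathsf Y_i(\mathsf D_{xy,i}-\mathsf E_{xy,i}).$$ Alice has two further projective measurements, with outcomes in $\{0,1,2,3\}^{\lfloor n/2\rfloor}$ and $\{0,1,2,3\}^{\lfloor (n-1)/2\rfloor}$ respectively; $\mathsf S_{l,a}$ and $\mathsf T_{l,a}$ denote the projectors onto the outcomes whose $l$-th entry is $a$. **Table I within $\eta$.** For all $l$ and all $a$, $\big|\langle\psi|\mathsf S_{l,a}|\psi\rangle-\tfrac14\big|\le\eta$ and $\big|\langle\psi|\mathsf P_{2l-1}\mathsf P_{2l}\otimes\mathsf S_{l,a}|\psi\rangle-\tfrac14 s_P(a)\big|\le\eta$ for $\mathsf P\in\{\mathsf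 Z,\mathsf X,\mathsf Y\}$, where for $a=0,1,2,3$ one has $s_Z=(1,1,-1,-1)$, $s_X=(1,-1,1,-1)$, $s_Y=(-1,1,1,-1)$; and the same with $\mathsf T_{l,a}$ and $\mathsf P_{2l}\mathsf P_{2l+1}$ in place of $\mathsf S_{l,a}$ and $\mathsf P_{2l-1}\mathsf P_{2l}$. **Extraction with error $\delta$.** Add $n$-qubit registers $C'',C'$ to Charlie's side and $A'',A'$ to Alice's side, all initialised in $|0\cdots0\rangle$ (jointly written $|00\rangle$), and write $|\Phi\rangle=\bigotimes_{i=1}^n|\Phi^+\rangle^{C_i'A_i'}$. An extraction with error $\delta$ is a local unitary $U=U_C\otimes U_A$, where $U_C$ acts on $\mathcal H_C\otimes C''\otimes C'$ and $U_A$ on $\mathcal H_A\otimes A''\otimes A'$, together with a unit vector $|\xi\rangle=\sum_{\bar q\in\{0,1\}^n}|\xi_{\bar q}\rangle^{CA}\otimes|\bar q\bar q\rangle^{C''A''}$ such that $$\big\|U[|\psi\rangle\otimes|00\rangle]-|\xi\rangle\otimes|\Phi\rangle\big\|\le\delta,\qquad \big\|U[\mathsf P_j|\psi\rangle\otimes|00\rangle]-\hat{\mathsf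 P}_j\,(|\xi\rangle\otimes|\Phi\rangle)\big\|\le\delta$$ for all $j$ and all $\mathsf P\in\{\mathsf Z,\mathsf X,\mathsf Y\}$, where $\hat{\mathsf Z}_j=\sigma_z^{C_j'}$, $\hat{\mathsf X}_j=\sigma_x^{C_j'}$ and $\hat{\mathsf Y}_j=\sigma_z^{C_j''}\otimes\sigma_y^{C_j'}$. **Theorem.** There is an absolute constant $K>0$ such that the following holds for all $n\ge1$, all $\mathcal H_C,\mathcal H_A$ and all $C\ge0$, $m>0$, $\varepsilon_0>0$. Suppose that Lemma 2 (the parallel self-test) holds robustly with error $O(\varepsilon^m)$, in the sense that for every $\varepsilon\in[0,\varepsilon_0]$ each state with measurements as above on $\mathcal H_C\otimes\mathcal H_A$ satisfying $\langle\psi|\mathcal B_i|\psi\rangle\ge6\sqrt2-\varepsilon$ for all $i$ has an extraction with error $C\varepsilon^m$. Let $\varepsilon\in[0,\varepsilon_0]$, $\eta\ge0$, and suppose that $\langle\psi|\mathcal B_i|\psi\rangle\ge6\sqrt2-\varepsilon$ for all $i$ and that Table I holds within $\eta$. Then an extraction with error $C\varepsilon^m$ exists, and for every such extraction $(U,|\xi\rangle)$,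 with $|\tilde\xi\rangle=|\xi_{0\cdots0}\rangle\otimes|0\cdots0\rangle^{C''A''}+|\xi_{1\cdots1}\rangle\otimes|1\cdots1\rangle^{C''A''}$, one has 1. $\big\||\xi\rangle-|\tilde\xi\rangle\big\|\le K\sqrt n\,(\sqrt\eta+C\varepsilon^m)$; 2. for every $\mathsf P\in\{\mathsf Z,\mathsf X,\mathsf Y\}$ and all distinct indices $j_1,\dots,j_k$ (in any order, $0\le k\le n$), $$\big\|U[\mathsf P_{j_1}\cdots\mathsf P_{j_k}|\psi\rangle\otimes|00\rangle]-\hat{\mathsf P}_{j_1}\cdots\hat{\mathsf P}_{j_k}(|\tilde\xi\rangle\otimes|\Phi\rangle)\big\|\le K\big(\sqrt n(\sqrt\eta+C\varepsilon^m)+k\,C\varepsilon^m\big).$$ In particular, for fixed $n$ the self-testing relations for the state ($k=0$), for each single observable ($k=1$), and for the full products $\prod_j\mathsf Z_j$, $\prod_j\mathsf X_j$, $\prod_j\mathsf Y_j$ ($k=n$) hold with the aligned junk state $|\tilde\xi\rangle$ up to $O(\varepsilon^m)+O(\sqrt\eta)$. -/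

import Mathlib

noncomputable section

namespace ParallelPauli

open scoped TensorProduct

/-! ### Hilbert space tensor products -/

/-- The Hilbert space tensor product: the completion of the algebraic tensor product in the
inner product with `⟪a ⊗ b, c ⊗ d⟫ = ⟪a, c⟫ * ⟪b, d⟫`. -/
abbrev HTensor (H K : Type*) [NormedAddCommGroup H] [InnerProductSpace ℂ H]
    [NormedAddCommGroup K] [InnerProductSpace ℂ K] : Type _ :=
  UniformSpace.Completion (H ⊗[ℂ] K)

section Tensor

variable {H K H' K' : Type*} [NormedAddCommGroup H] [InnerProductSpace ℂ H]
  [NormedAddCommGroup K] [InnerProductSpace ℂ K]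
  [NormedAddCommGroup H'] [InnerProductSpace ℂ H']
  [NormedAddCommGroup K'] [InnerProductSpace ℂ K']

/-- The bounded operator `A ⊗ B` between Hilbert space tensor products. -/
def tmap (A : H →L[ℂ] H') (B : K →L[ℂ] K') : HTensor H K →L[ℂ] HTensor H' K' :=
  (TensorProduct.mapL A B).completion

/-- The elementary tensor `x ⊗ y`, as a bounded operator `x ↦ x ⊗ y`. -/
def attach (y : K) : H →L[ℂ] HTensor H K :=
  UniformSpace.Completion.toComplL.comp ((TensorProduct.mkL ℂ H K).flip y)

/-- The expectation value `⟨ψ| A ⊗ B |ψ⟩`. -/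
def expect (ψ : HTensor H K) (A : H →L[ℂ] H) (B : K →L[ℂ] K) : ℂ :=
  inner ℂ ψ (tmap A B ψ)

theorem tmap_tmul (A : H →L[ℂ] H') (B : K →L[ℂ] K') (x : H) (y : K) :
    tmap A B ((x ⊗ₜ[ℂ] y : H ⊗[ℂ] K) : HTensor H K)
      = ((A x ⊗ₜ[ℂ] B y : H' ⊗[ℂ] K') : HTensor H' K') := by
  simp [tmap]

theorem attach_apply (x : H) (y : K) :
    attach y x = ((x ⊗ₜ[ℂ] y : H ⊗[ℂ] K) : HTensor H K) := rfl

end Tensor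

/-! ### Qubit registers and Pauli operators -/

/-- The three Pauli labels. -/
inductive Pauli
  | Z
  | X
  | Y
  deriving DecidableEq

instance : Fintype Pauli := ⟨{.Z, .X, .Y}, by rintro (_ | _ | _) <;> simp⟩

/-- The Pauli matrices `σ_z`, `σ_x`, `σ_y`. -/
def Pauli.matrix : Pauli → Matrix (Fin 2) (Fin 2) ℂ
  | .Z => !![1, 0; 0, -1]
  | .X => !![0, 1; 1, 0]
  | .Y => !![0, -Complex.I; Complex.I, 0]

/-- A register of `n` qubits, `(ℂ²)^{⊗ n}`, with its computational basis labelled by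
bit strings. -/
abbrev Qubits (n : ℕ) : Type := EuclideanSpace ℂ (Fin n → Fin 2)

/-- The computational basis vector `|q⟩`. -/
def ket {n : ℕ} (q : Fin n → Fin 2) : Qubits n := EuclideanSpace.single q 1

/-- The Pauli operator `P` acting on the `j`-th qubit, identity on the other qubits. -/
def pauliAt {n : ℕ} (P : Pauli) (j : Fin n) : Qubits n →L[ℂ] Qubits n :=
  Matrix.toEuclideanCLM (𝕜 := ℂ)
    (Matrix.of fun p q : Fin n → Fin 2 =>
      if ∀ i, i ≠ j → p i = q i then P.matrix (p j) (q j) else 0)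

/-! ### Measurements and strategies -/

/-- A projective measurement on `H` with outcomes in `ι`. -/
structure ProjMeas (ι : Type*) [Fintype ι] (H : Type*) [NormedAddCommGroup H]
    [InnerProductSpace ℂ H] [CompleteSpace H] where
  proj : ι → H →L[ℂ] H
  isProj : ∀ a, IsStarProjection (proj a)
  orth : ∀ a b, a ≠ b → proj a * proj b = 0
  sum_eq_one : ∑ a, proj a = 1

/-- The `±1`-valued observable reading off the `i`-th component of an outcome string. -/
def ProjMeas.bitObs {n : ℕ} {H : Type*} [NormedAddCommGroup H] [InnerProductSpace ℂ H]
    [CompleteSpace H] (M : ProjMeas (Fin n → ℤˣ) H) (i : Fin n) : H →L[ℂ] H :=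
  ∑ c with c i = 1, M.proj c - ∑ c with c i = -1, M.proj c

/-- The projector onto the outcomes whose `l`-th component is `a`. -/
def ProjMeas.marginal {k : ℕ} {H : Type*} [NormedAddCommGroup H] [InnerProductSpace ℂ H]
    [CompleteSpace H] (M : ProjMeas (Fin k → Fin 4) H) (l : Fin k) (a : Fin 4) : H →L[ℂ] H :=
  ∑ b with b l = a, M.proj b

/-- Alice's six local settings `1, …, 6`. -/
inductive AliceSetting
  | Dzx
  | Ezx
  | Dzy
  | Ezy
  | Dxy
  | Exy
  deriving DecidableEq

instance : Fintype AliceSetting :=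
  ⟨{.Dzx, .Ezx, .Dzy, .Ezy, .Dxy, .Exy}, by rintro (_ | _ | _ | _ | _ | _) <;> simp⟩

/-- A state shared by Charlie and Alice, Charlie's `3 ^ n` projective measurements (the `i`-th
setting `1, 2, 3` is called `Z, X, Y`) and Alice's `6 ^ n` projective measurements, each with
outcomes in `{±1}ⁿ`. -/
structure Strategy (n : ℕ) (HC HA : Type*)
    [NormedAddCommGroup HC] [InnerProductSpace ℂ HC] [CompleteSpace HC]
    [NormedAddCommGroup HA] [InnerProductSpace ℂ HA] [CompleteSpace HA] where
  ψ : HTensor HC HA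
  norm_ψ : ‖ψ‖ = 1
  measC : (Fin n → Pauli) → ProjMeas (Fin n → ℤˣ) HC
  measA : (Fin n → AliceSetting) → ProjMeas (Fin n → ℤˣ) HA

/-- Alice's two additional measurements: `lozenge` with `4 ^ ⌊n/2⌋` outcomes and `blackLozenge`
with `4 ^ ⌊(n-1)/2⌋` outcomes. -/
structure BellMeasurements (n : ℕ) (HA : Type*)
    [NormedAddCommGroup HA] [InnerProductSpace ℂ HA] [CompleteSpace HA] where
  lozenge : ProjMeas (Fin (n / 2) → Fin 4) HA
  blackLozenge : ProjMeas (Fin ((n - 1) / 2) → Fin 4) HA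

section Scenario

variable {n : ℕ} {HC HA : Type*}
  [NormedAddCommGroup HC] [InnerProductSpace ℂ HC] [CompleteSpace HC]
  [NormedAddCommGroup HA] [InnerProductSpace ℂ HA] [CompleteSpace HA]

namespace Strategy

/-- Charlie's averaged observables `Z_i`, `X_i`, `Y_i`. -/
def obsC (s : Strategy n HC HA) (P : Pauli) (i : Fin n) : HC →L[ℂ] HC :=
  ((1 : ℂ) / 3 ^ (n - 1)) • ∑ z with z i = P, (s.measC z).bitObs i

/-- Alice's averaged observables `D_{zx,i}`, `E_{zx,i}`, `D_{zy,i}`, … -/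
def obsA (s : Strategy n HC HA) (x : AliceSetting) (i : Fin n) : HA →L[ℂ] HA :=
  ((1 : ℂ) / 6 ^ (n - 1)) • ∑ y with y i = x, (s.measA y).bitObs i

/-- The triple CHSH Bell operator `B_i`. -/
def bellOp (s : Strategy n HC HA) (i : Fin n) : HTensor HC HA →L[ℂ] HTensor HC HA :=
  tmap (s.obsC .Z i) (s.obsA .Dzx i + s.obsA .Ezx i)
    + tmap (s.obsC .X i) (s.obsA .Dzx i - s.obsA .Ezx i)
    + tmap (s.obsC .Z i) (s.obsA .Dzy i + s.obsA .Ezy i)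
    - tmap (s.obsC .Y i) (s.obsA .Dzy i - s.obsA .Ezy i)
    + tmap (s.obsC .X i) (s.obsA .Dxy i + s.obsA .Exy i)
    - tmap (s.obsC .Y i) (s.obsA .Dxy i - s.obsA .Exy i)

/-- The Bell value `⟨ψ|B_i|ψ⟩` (a real number, as `B_i` is self-adjoint). -/
def bellValue (s : Strategy n HC HA) (i : Fin n) : ℝ :=
  (inner ℂ s.ψ (s.bellOp i s.ψ)).re

end Strategy

/-- The signs of the Bell states `Φ⁺, Φ⁻, Ψ⁺, Ψ⁻` under `σ_P ⊗ σ_P`. -/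
def bellSign : Pauli → Fin 4 → ℂ
  | .Z => ![1, 1, -1, -1]
  | .X => ![1, -1, 1, -1]
  | .Y => ![-1, 1, 1, -1]

/-- All correlations between the additional measurements and the column operators `1`,
`Z_j Z_{j+1}`, `X_j X_{j+1}`, `Y_j Y_{j+1}` are `η`-close to their ideal values `1/4` and `± 1/4`.
Sites are numbered from `0`: the `l`-th block of `lozenge` sits on the sites `2l, 2l+1`, the
`l`-th block of `blackLozenge` on the sites `2l+1, 2l+2`. -/
def TableWithin (s : Strategy n HC HA) (b : BellMeasurements n HA) (η : ℝ) : Prop :=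
  (∀ (l : Fin (n / 2)) (a : Fin 4),
    ‖expect s.ψ 1 (b.lozenge.marginal l a) - 1 / 4‖ ≤ η ∧
    ∀ P : Pauli,
      ‖expect s.ψ (s.obsC P ⟨2 * l, by have := l.2; omega⟩
            * s.obsC P ⟨2 * l + 1, by have := l.2; omega⟩) (b.lozenge.marginal l a)
          - bellSign P a / 4‖ ≤ η) ∧
  (∀ (l : Fin ((n - 1) / 2)) (a : Fin 4),
    ‖expect s.ψ 1 (b.blackLozenge.marginal l a) - 1 / 4‖ ≤ η ∧
    ∀ P : Pauli,
      ‖expect s.ψ (s.obsC P ⟨2 * l + 1, by have := l.2; omega⟩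
            * s.obsC P ⟨2 * l + 2, by have := l.2; omega⟩) (b.blackLozenge.marginal l a)
          - bellSign P a / 4‖ ≤ η)

end Scenario

/-! ### Extraction by a local unitary -/

/-- A laboratory with its ancillas, `H ⊗ H'' ⊗ H'`, where `H''` and `H'` are `n`-qubit registers. -/
abbrev Lab (n : ℕ) (H : Type*) [NormedAddCommGroup H] [InnerProductSpace ℂ H] : Type _ :=
  HTensor (HTensor H (Qubits n)) (Qubits n)

section Extraction

variable {n : ℕ} {H K : Type*} [NormedAddCommGroup H] [InnerProductSpace ℂ H]
  [NormedAddCommGroup K] [InnerProductSpace ℂ K]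

/-- Attach the same register state `|q⟩` on both sides: `v ↦ v ⊗ |q q⟩`. -/
def attachBoth (q : Fin n → Fin 2) :
    HTensor H K →L[ℂ] HTensor (HTensor H (Qubits n)) (HTensor K (Qubits n)) :=
  tmap (attach (ket q)) (attach (ket q))

/-- `v ↦ v ⊗ |00⟩`, all four ancilla registers being initialised in `|0…0⟩`. -/
def attachZero (n : ℕ) (v : HTensor H K) : HTensor (Lab n H) (Lab n K) :=
  attachBoth (0 : Fin n → Fin 2) (attachBoth (0 : Fin n → Fin 2) v)

/-- `v ↦ v ⊗ (⊗ᵢ Φ⁺)`, where `⊗ᵢ Φ⁺ = 2^{-n/2} ∑_p |p⟩|p⟩` on the two registers. -/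
def attachPhi (n : ℕ) (v : HTensor H K) :
    HTensor (HTensor H (Qubits n)) (HTensor K (Qubits n)) :=
  ((1 / Real.sqrt 2 : ℝ) ^ n : ℂ) • ∑ p : Fin n → Fin 2, attachBoth p v

/-- The junk state `∑_q ξ_q ⊗ |q q⟩`. -/
def junk (ξ : (Fin n → Fin 2) → HTensor H K) :
    HTensor (HTensor H (Qubits n)) (HTensor K (Qubits n)) :=
  ∑ q, attachBoth q (ξ q)

/-- The aligned part `ξ_{0…0} ⊗ |0…0⟩ + ξ_{1…1} ⊗ |1…1⟩` of a junk state. -/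
def alignedJunk (ξ : (Fin n → Fin 2) → HTensor H K) :
    HTensor (HTensor H (Qubits n)) (HTensor K (Qubits n)) :=
  attachBoth (fun _ => 0) (ξ fun _ => 0) + attachBoth (fun _ => 1) (ξ fun _ => 1)

/-- The ideal counterpart of Charlie's observable `P_j`: it is `σ_P` on the `j`-th qubit of `H'`,
together with `σ_z` on the `j`-th qubit of `H''` if `P = Y`. -/
def idealObs (P : Pauli) (j : Fin n) : Lab n H →L[ℂ] Lab n H :=
  tmap (if P = .Y then tmap 1 (pauliAt .Z j) else 1) (pauliAt P j)

end Extraction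

/-- A local unitary `U = UC ⊗ UA` together with a normalised junk state `∑_q ξ_q ⊗ |q q⟩`. -/
structure Extraction (n : ℕ) (HC HA : Type*)
    [NormedAddCommGroup HC] [InnerProductSpace ℂ HC]
    [NormedAddCommGroup HA] [InnerProductSpace ℂ HA] where
  UC : Lab n HC ≃ₗᵢ[ℂ] Lab n HC
  UA : Lab n HA ≃ₗᵢ[ℂ] Lab n HA
  ξ : (Fin n → Fin 2) → HTensor HC HA
  norm_junk : ‖junk ξ‖ = 1

section Robust

variable {n : ℕ} {HC HA : Type*}
  [NormedAddCommGroup HC] [InnerProductSpace ℂ HC] [CompleteSpace HC]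
  [NormedAddCommGroup HA] [InnerProductSpace ℂ HA] [CompleteSpace HA]

/-- `U [v ⊗ |00⟩]`. -/
def Extraction.run (E : Extraction n HC HA) (v : HTensor HC HA) :
    HTensor (Lab n HC) (Lab n HA) :=
  tmap (E.UC : Lab n HC →L[ℂ] Lab n HC) (E.UA : Lab n HA →L[ℂ] Lab n HA) (attachZero n v)

/-- The relations of the parallel self-test hold up to error `δ` for the state and for each of the
observables `Z_j`, `X_j`, `Y_j`. -/
def Extraction.SelfTests (E : Extraction n HC HA) (s : Strategy n HC HA) (δ : ℝ) : Prop :=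
  ‖E.run s.ψ - attachPhi n (junk E.ξ)‖ ≤ δ ∧
  ∀ (P : Pauli) (j : Fin n),
    ‖E.run (tmap (s.obsC P j) 1 s.ψ)
      - tmap (idealObs P j) 1 (attachPhi n (junk E.ξ))‖ ≤ δ

/-- The parallel self-test on `HC ⊗ HA` is robust with error `C * ε ^ m` for `0 ≤ ε ≤ ε₀`: each
strategy whose Bell values are all within `ε` of the maximum `6√2` admits an extraction with that
error. -/
def RobustParallelSelfTest (n : ℕ) (HC HA : Type*)
    [NormedAddCommGroup HC] [InnerProductSpace ℂ HC] [CompleteSpace HC]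
    [NormedAddCommGroup HA] [InnerProductSpace ℂ HA] [CompleteSpace HA]
    (C m ε₀ : ℝ) : Prop :=
  ∀ ε : ℝ, 0 ≤ ε → ε ≤ ε₀ → ∀ s : Strategy n HC HA,
    (∀ i, 6 * Real.sqrt 2 - ε ≤ s.bellValue i) →
    ∃ E : Extraction n HC HA, E.SelfTests s (C * ε ^ m)

end Robust

end ParallelPauli

end

open ParallelPauli

/-! The Bell measurements force alignment because they tie together the signs of `Y` on neighbouring
sites. Write Ψ for the ideal state ξ ⊗ Φ. A correlation ±1/4 with a projector of weight 1/4
saturates Cauchy–Schwarz. So, up to O(√η), Charlie's product P_j P_{j+1} acts on ψ like Alice's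
operator W_P = ∑ s_P(a) S_a (`norm_sub_smul_le`, `norm_pair_sub_combine_le`). Conjugation by U
transfers this to the ideal operators on Ψ at a cost of O(δ), where δ is the extraction error.

The Bell signs satisfy s_X s_Z = -s_Y, hence W_X W_Z = -W_Y and ẐẐX̂X̂Ψ ≈ -ŶŶΨ on each neighbouring
pair (`norm_mul_add_apply_le`). The exact identity is ẐẐX̂X̂ = -ŶŶD with D = σ_z ⊗ σ_z on the pair's
junk qubits (`idealObs_ZZXX`), so DΨ ≈ Ψ. Since D is diagonal with eigenvalue -1 exactly where the
two bits of q differ, those components ξ_q have small total weight (`norm_sub_ZZ_sq`). A nonconstant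
string changes at some adjacent pair; summing squared weights over at most n pairs gives the factor
√n.

For products of k observables, each ideal observable acting on Ψ can be moved to Alice's side:
Paulis by transposition on Φ, and σ_z on the junk because both registers carry the same q. There it
commutes with Charlie's remaining operators, so factors are exchanged one at a time and the error is
linear in k (`norm_prod_sub_prod_le`). -/

noncomputable section

namespace ParallelPauli

open scoped TensorProduct

/-! ### Calculus of operators on completed tensor products -/

section TensorLemmas

variable {H K H' K' H'' K'' E : Type*} [NormedAddCommGroup H] [InnerProductSpace ℂ H]
  [NormedAddCommGroup K] [InnerProductSpace ℂ K]
  [NormedAddCommGroup H'] [InnerProductSpace ℂ H']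
  [NormedAddCommGroup K'] [InnerProductSpace ℂ K']
  [NormedAddCommGroup H''] [InnerProductSpace ℂ H'']
  [NormedAddCommGroup K''] [InnerProductSpace ℂ K'']
  [NormedAddCommGroup E] [InnerProductSpace ℂ E]

/-- Bounded operators on a Hilbert space tensor product agree if they agree on elementary
tensors. -/
theorem htensor_ext {f g : HTensor H K →L[ℂ] E}
    (h : ∀ x y, f ((x ⊗ₜ[ℂ] y : H ⊗[ℂ] K) : HTensor H K)
      = g ((x ⊗ₜ[ℂ] y : H ⊗[ℂ] K) : HTensor H K)) : f = g := by
  ext v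
  induction v using UniformSpace.Completion.induction_on with
  | hp => exact isClosed_eq f.continuous g.continuous
  | ih a =>
    induction a using TensorProduct.induction_on with
    | zero => rw [UniformSpace.Completion.coe_zero, map_zero, map_zero]
    | tmul x y => exact h x y
    | add x y hx hy => simp [UniformSpace.Completion.coe_add, hx, hy]

theorem tmap_comp (A' : H' →L[ℂ] H'') (B' : K' →L[ℂ] K'') (A : H →L[ℂ] H') (B : K →L[ℂ] K') :
    (tmap A' B').comp (tmap A B) = tmap (A'.comp A) (B'.comp B) :=
  htensor_ext fun x y => by simp [tmap_tmul]

theorem tmap_tmap_apply (A' : H' →L[ℂ] H'') (B' : K' →L[ℂ] K'') (A : H →L[ℂ] H')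
    (B : K →L[ℂ] K') (v : HTensor H K) :
    tmap A' B' (tmap A B v) = tmap (A'.comp A) (B'.comp B) v := by
  rw [← tmap_comp]; rfl

theorem tmap_mul (A' A : H →L[ℂ] H) (B' B : K →L[ℂ] K) :
    tmap A' B' * tmap A B = tmap (A' * A) (B' * B) :=
  tmap_comp A' B' A B

@[simp] theorem tmap_one : tmap (1 : H →L[ℂ] H) (1 : K →L[ℂ] K) = 1 :=
  htensor_ext fun x y => by simp [tmap_tmul]

theorem tmap_smul_left (c : ℂ) (A : H →L[ℂ] H') (B : K →L[ℂ] K') :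
    tmap (c • A) B = c • tmap A B :=
  htensor_ext fun x y => by
    simp [tmap_tmul, ← TensorProduct.smul_tmul', UniformSpace.Completion.coe_smul]

theorem tmap_smul_right (c : ℂ) (A : H →L[ℂ] H') (B : K →L[ℂ] K') :
    tmap A (c • B) = c • tmap A B :=
  htensor_ext fun x y => by
    simp [tmap_tmul, TensorProduct.tmul_smul, UniformSpace.Completion.coe_smul]

theorem tmap_add_right (A : H →L[ℂ] H') (B B' : K →L[ℂ] K') :
    tmap A (B + B') = tmap A B + tmap A B' :=
  htensor_ext fun x y => by
    simp [tmap_tmul, TensorProduct.tmul_add, UniformSpace.Completion.coe_add]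

theorem tmap_sum_right {ι : Type*} (s : Finset ι) (A : H →L[ℂ] H') (B : ι → K →L[ℂ] K') :
    tmap A (∑ i ∈ s, B i) = ∑ i ∈ s, tmap A (B i) := by
  classical
  induction s using Finset.induction_on with
  | empty => simpa using tmap_smul_right 0 A (0 : K →L[ℂ] K')
  | insert i s hi ih => rw [Finset.sum_insert hi, Finset.sum_insert hi, tmap_add_right, ih]

theorem norm_tmap_le (A : H →L[ℂ] H') (B : K →L[ℂ] K') : ‖tmap A B‖ ≤ ‖A‖ * ‖B‖ := by
  refine ContinuousLinearMap.opNorm_le_bound _ (by positivity) fun v => ?_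
  induction v using UniformSpace.Completion.induction_on with
  | hp => exact isClosed_le (by fun_prop) (by fun_prop)
  | ih a =>
    rw [tmap, ContinuousLinearMap.completion_apply_coe, UniformSpace.Completion.norm_coe,
      UniformSpace.Completion.norm_coe]
    exact ((TensorProduct.mapL A B).le_opNorm a).trans
      (mul_le_mul_of_nonneg_right (TensorProduct.norm_mapL_le A B) (norm_nonneg _))

theorem norm_tmap_le_one {A : H →L[ℂ] H'} {B : K →L[ℂ] K'} (hA : ‖A‖ ≤ 1) (hB : ‖B‖ ≤ 1) :
    ‖tmap A B‖ ≤ 1 :=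
  (norm_tmap_le A B).trans (mul_le_one₀ hA (norm_nonneg _) hB)

theorem norm_one_le : ‖(1 : H →L[ℂ] H)‖ ≤ 1 := ContinuousLinearMap.norm_id_le

/-- A contraction does not increase distances to a given point. -/
theorem norm_apply_sub_le {A : H →L[ℂ] H'} (hA : ‖A‖ ≤ 1) (x y : H) :
    ‖A x - A y‖ ≤ ‖x - y‖ := by
  rw [← map_sub]; exact A.le_of_opNorm_le_of_le hA le_rfl |>.trans (by simp)

theorem norm_apply_le_of_contraction {A : H →L[ℂ] H'} (hA : ‖A‖ ≤ 1) (x : H) : ‖A x‖ ≤ ‖x‖ := by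
  simpa using norm_apply_sub_le hA x 0

/-- Two sesquilinear expressions of the form `⟪f v, g w⟫` and `⟪v, h w⟫` agree if they agree on
elementary tensors. -/
theorem inner_htensor_ext {f : HTensor H K →L[ℂ] E} {g : HTensor H' K' →L[ℂ] E}
    {h : HTensor H' K' →L[ℂ] HTensor H K}
    (hfg : ∀ x y x' y', inner ℂ (f ((x ⊗ₜ[ℂ] y : H ⊗[ℂ] K) : HTensor H K))
        (g ((x' ⊗ₜ[ℂ] y' : H' ⊗[ℂ] K') : HTensor H' K'))
      = inner ℂ ((x ⊗ₜ[ℂ] y : H ⊗[ℂ] K) : HTensor H K)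
        (h ((x' ⊗ₜ[ℂ] y' : H' ⊗[ℂ] K') : HTensor H' K')))
    (v : HTensor H K) (w : HTensor H' K') : inner ℂ (f v) (g w) = inner ℂ v (h w) := by
  induction v using UniformSpace.Completion.induction_on with
  | hp => exact isClosed_eq (by fun_prop) (by fun_prop)
  | ih a =>
    induction a using TensorProduct.induction_on with
    | zero => rw [UniformSpace.Completion.coe_zero, map_zero, inner_zero_left, inner_zero_left]
    | add x y hx hy =>
      simp only [UniformSpace.Completion.coe_add, map_add, inner_add_left, hx, hy]
    | tmul x y =>
      have := DFunLike.congr_fun (htensor_ext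
        (f := (innerSL ℂ (f ((x ⊗ₜ[ℂ] y : H ⊗[ℂ] K) : HTensor H K))).comp g)
        (g := (innerSL ℂ ((x ⊗ₜ[ℂ] y : H ⊗[ℂ] K) : HTensor H K)).comp h)
        (fun x' y' => by simpa using hfg x y x' y')) w
      simpa using this

/-- Adjoint pairs are passed as hypotheses because the factors are not assumed complete. -/
theorem inner_tmap_left {A : H →L[ℂ] H'} {A' : H' →L[ℂ] H} {B : K →L[ℂ] K'} {B' : K' →L[ℂ] K}
    (hA : ∀ x y, inner ℂ (A x) y = inner ℂ x (A' y))
    (hB : ∀ x y, inner ℂ (B x) y = inner ℂ x (B' y)) (v : HTensor H K) (w : HTensor H' K') :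
    inner ℂ (tmap A B v) w = inner ℂ v (tmap A' B' w) := by
  have := inner_htensor_ext (f := tmap A B) (g := ContinuousLinearMap.id ℂ _)
    (h := tmap A' B')
    (fun x y x' y' => by simp [tmap_tmul, UniformSpace.Completion.inner_coe, hA, hB]) v w
  simpa using this

/-! ### Attaching vectors -/

theorem tmap_comp_attach (A : H →L[ℂ] H') (B : K →L[ℂ] K') (y : K) :
    (tmap A B).comp (attach y) = (attach (B y)).comp A := by
  ext x
  simp [attach_apply, tmap_tmul]

theorem attach_smul (c : ℂ) (y : K) : attach (H := H) (c • y) = c • attach y := by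
  ext x
  simp [attach_apply, TensorProduct.tmul_smul, UniformSpace.Completion.coe_smul]

theorem inner_attach_attach (x y : H) (a b : K) :
    inner ℂ (attach a x) (attach b y) = inner ℂ a b * inner ℂ x y := by
  simp [attach_apply, UniformSpace.Completion.inner_coe, mul_comm]

theorem inner_tmap_attach (a b : H') (c d : K') (v w : HTensor H K) :
    inner ℂ (tmap (attach a) (attach c) v) (tmap (attach b) (attach d) w)
      = inner ℂ a b * inner ℂ c d * inner ℂ v w := by
  have := inner_htensor_ext (f := tmap (attach (H := H) a) (attach (H := K) c))
    (g := tmap (attach (H := H) b) (attach (H := K) d))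
    (h := (inner ℂ a b * inner ℂ c d : ℂ) • ContinuousLinearMap.id ℂ _)
    (fun x y x' y' => by
      simp [tmap_tmul, UniformSpace.Completion.inner_coe, inner_attach_attach, inner_smul_right]
      ring) v w
  simpa [inner_smul_right] using this

theorem tmap_tmap_attach (A : H →L[ℂ] H) (B : K →L[ℂ] K) (M : H' →L[ℂ] H') (N : K' →L[ℂ] K')
    (a : H') (c : K') (v : HTensor H K) :
    tmap (tmap A M) (tmap B N) (tmap (attach a) (attach c) v)
      = tmap (attach (M a)) (attach (N c)) (tmap A B v) := by
  rw [tmap_tmap_apply, tmap_tmap_apply, tmap_comp_attach, tmap_comp_attach]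

end TensorLemmas

/-! ### Pauli operators on the computational basis -/

/-- The bit to which `σ_P` maps a bit, up to a phase. -/
def Pauli.act : Pauli → Fin 2 → Fin 2
  | .Z => id
  | _ => ![1, 0]

/-- The phase with which `σ_P` maps a bit. -/
def Pauli.phase : Pauli → Fin 2 → ℂ
  | .Z => ![1, -1]
  | .X => 1
  | .Y => ![Complex.I, -Complex.I]

/-- The sign of `σ_P` under transposition. -/
def Pauli.transposeSign : Pauli → ℂ
  | .Y => -1
  | _ => 1

theorem Pauli.matrix_apply (P : Pauli) (a b : Fin 2) :
    P.matrix a b = if a = P.act b then P.phase b else 0 := by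
  cases P <;> fin_cases a <;> fin_cases b <;> simp [Pauli.matrix, Pauli.act, Pauli.phase]

@[simp] theorem Pauli.act_act (P : Pauli) (b : Fin 2) : P.act (P.act b) = b := by
  cases P <;> fin_cases b <;> simp [Pauli.act]

theorem Pauli.phase_act (P : Pauli) (b : Fin 2) :
    P.phase (P.act b) = P.transposeSign * P.phase b := by
  cases P <;> fin_cases b <;> simp [Pauli.act, Pauli.phase, Pauli.transposeSign]

theorem Pauli.phase_act_mul_phase (P : Pauli) (b : Fin 2) :
    P.phase (P.act b) * P.phase b = 1 := by
  cases P <;> fin_cases b <;> simp [Pauli.act, Pauli.phase]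

theorem Pauli.norm_transposeSign (P : Pauli) : ‖P.transposeSign‖ = 1 := by
  cases P <;> simp [Pauli.transposeSign]

theorem Pauli.conjTranspose_matrix (P : Pauli) (a b : Fin 2) :
    star (P.matrix a b) = P.matrix b a := by
  cases P <;> fin_cases a <;> fin_cases b <;> simp [Pauli.matrix]

section Qubits

variable {n : ℕ}

theorem qubits_ext {f g : Qubits n →L[ℂ] Qubits n} (h : ∀ q, f (ket q) = g (ket q)) : f = g := by
  have : (f : Qubits n →ₗ[ℂ] Qubits n) = g :=
    (EuclideanSpace.basisFun (Fin n → Fin 2) ℂ).toBasis.ext fun q => by simpa [ket] using h q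
  ext1 x
  exact DFunLike.congr_fun this x

theorem inner_ket_ket (p q : Fin n → Fin 2) :
    inner ℂ (ket p) (ket q) = if p = q then (1 : ℂ) else 0 := by
  simp [ket, EuclideanSpace.inner_single_left]

/-- A Pauli matrix is monomial: one nonzero entry per column. Operator identities between Paulis
thus become finite checks on bits and phases. -/
theorem pauliAt_ket (P : Pauli) (j : Fin n) (q : Fin n → Fin 2) :
    pauliAt P j (ket q) = P.phase (q j) • ket (Function.update q j (P.act (q j))) := by
  ext p
  have h1 : pauliAt P j (ket q) p
      = if ∀ i, i ≠ j → p i = q i then P.matrix (p j) (q j) else 0 := by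
    simp [pauliAt, ket, Matrix.mulVec_single]
  rw [h1]
  have h2 : p = Function.update q j (P.act (q j)) ↔
      (p j = P.act (q j) ∧ ∀ i, i ≠ j → p i = q i) := Function.eq_update_iff
  by_cases h : ∀ i, i ≠ j → p i = q i
  · rw [if_pos h, P.matrix_apply]
    by_cases h' : p j = P.act (q j)
    · simp [ket, h2.2 ⟨h', h⟩]
    · have : p ≠ Function.update q j (P.act (q j)) := fun e => h' (h2.1 e).1
      simp [ket, h', this]
  · have : p ≠ Function.update q j (P.act (q j)) := fun e => h (h2.1 e).2
    rw [if_neg h]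
    simp [ket, this]

theorem pauliAt_Z_ket (j : Fin n) (q : Fin n → Fin 2) :
    pauliAt .Z j (ket q) = Pauli.phase .Z (q j) • ket q := by
  simp [pauliAt_ket, Pauli.act]

theorem pauliAt_mul_self (P : Pauli) (j : Fin n) : pauliAt P j * pauliAt P j = 1 :=
  qubits_ext fun q => by
    simp [pauliAt_ket, smul_smul, mul_comm (P.phase (q j)), P.phase_act_mul_phase]

theorem star_pauliAt (P : Pauli) (j : Fin n) : star (pauliAt P j) = pauliAt P j := by
  rw [pauliAt, ← map_star]
  congr 1
  ext p q
  simp only [Matrix.star_apply, Matrix.of_apply]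
  by_cases h : ∀ i, i ≠ j → p i = q i
  · rw [if_pos h, if_pos fun i hi => (h i hi).symm, P.conjTranspose_matrix]
  · rw [if_neg h, if_neg fun h' => h fun i hi => (h' i hi).symm, star_zero]

end Qubits

/-- This is the C*-identity. The bound is an inequality so that it also covers the zero space. -/
theorem norm_le_one_of_star_mul_self {H : Type*} [NormedAddCommGroup H] [InnerProductSpace ℂ H]
    [CompleteSpace H] {A : H →L[ℂ] H} (h : star A * A = 1) : ‖A‖ ≤ 1 := by
  have h1 : ‖A‖ * ‖A‖ ≤ 1 := by
    rw [← CStarRing.norm_star_mul_self, h]; exact norm_one_le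
  nlinarith [norm_nonneg A]

section Qubits

variable {n : ℕ}

theorem norm_pauliAt_le (P : Pauli) (j : Fin n) : ‖pauliAt P j‖ ≤ 1 :=
  norm_le_one_of_star_mul_self (by rw [star_pauliAt, pauliAt_mul_self])

/-- On one site σ_z σ_x = iσ_y; two distinct sites contribute i² = -1. -/
theorem pauliAt_ZZXX {j k : Fin n} (hjk : j ≠ k) :
    pauliAt .Z j * pauliAt .Z k * (pauliAt .X j * pauliAt .X k)
      = -(pauliAt .Y j * pauliAt .Y k) :=
  qubits_ext fun q => by
    have hq : ∀ b : Fin 2, b = 0 ∨ b = 1 := by decide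
    rcases hq (q j) with h | h <;> rcases hq (q k) with h' | h' <;>
      simp [pauliAt_ket .X, pauliAt_ket .Y, pauliAt_Z_ket, Pauli.phase, Pauli.act, hjk, hjk.symm,
        h, h', smul_smul]

theorem pauliAt_Z_mul_ket (j k : Fin n) (q : Fin n → Fin 2) :
    (pauliAt .Z j * pauliAt .Z k) (ket q) = (if q j = q k then (1 : ℂ) else -1) • ket q := by
  have hq : ∀ b : Fin 2, b = 0 ∨ b = 1 := by decide
  rcases hq (q j) with h | h <;> rcases hq (q k) with h' | h' <;>
    simp [pauliAt_Z_ket, Pauli.phase, h, h']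

theorem pauliAt_Z_mul_sq (j k : Fin n) :
    (pauliAt .Z j * pauliAt .Z k) * (pauliAt .Z j * pauliAt .Z k) = 1 :=
  qubits_ext fun q => by
    rw [mul_apply_eq_comp, pauliAt_Z_mul_ket, map_smul, pauliAt_Z_mul_ket, smul_smul]
    split_ifs <;> simp

end Qubits

/-! ### Junk states and maximally entangled registers -/

section Registers

variable {n : ℕ} {H K : Type*} [NormedAddCommGroup H] [InnerProductSpace ℂ H]
  [NormedAddCommGroup K] [InnerProductSpace ℂ K]

theorem inner_attachBoth (p q : Fin n → Fin 2) (v w : HTensor H K) :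
    inner ℂ (attachBoth p v) (attachBoth q w) = if p = q then inner ℂ v w else (0 : ℂ) := by
  rw [attachBoth, attachBoth, inner_tmap_attach, inner_ket_ket]
  split_ifs <;> simp

/-- Pythagoras: distinct labels q give orthogonal summands. -/
theorem norm_junk_sq (ξ : (Fin n → Fin 2) → HTensor H K) : ‖junk ξ‖ ^ 2 = ∑ q, ‖ξ q‖ ^ 2 := by
  have h : inner ℂ (junk ξ) (junk ξ) = ((∑ q, ‖ξ q‖ ^ 2 : ℝ) : ℂ) := by
    simp only [junk, sum_inner, inner_sum, inner_attachBoth]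
    simp [inner_self_eq_norm_sq_to_K]
  rw [inner_self_eq_norm_sq_to_K] at h
  exact Complex.ofReal_injective (by push_cast; simpa using h)

theorem junk_sub (ξ ξ' : (Fin n → Fin 2) → HTensor H K) :
    junk ξ - junk ξ' = junk fun q => ξ q - ξ' q := by
  simp [junk, Finset.sum_sub_distrib]

/-- For n = 0 the two constant strings coincide and the aligned part would count the same term
twice, hence `hn`. -/
theorem alignedJunk_eq_junk (hn : 1 ≤ n) (ξ : (Fin n → Fin 2) → HTensor H K) :
    alignedJunk ξ = junk fun q => if (q = fun _ => 0) ∨ (q = fun _ => 1) then ξ q else 0 := by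
  have h01 : (fun _ : Fin n => (0 : Fin 2)) ≠ fun _ => 1 := fun h => by
    simpa using congrFun h ⟨0, hn⟩
  rw [junk, ← Finset.sum_subset (Finset.subset_univ {fun _ => 0, fun _ => 1}),
    Finset.sum_pair h01]
  · simp [alignedJunk]
  · intro q _ hq
    simp only [Finset.mem_insert, Finset.mem_singleton] at hq
    simp [hq]

theorem attachPhi_eq (v : HTensor H K) :
    attachPhi n v = ((1 / Real.sqrt 2 : ℝ) ^ n : ℂ) • junk (fun _ : Fin n → Fin 2 => v) := rfl

theorem norm_attachPhi (v : HTensor H K) : ‖attachPhi n v‖ = ‖v‖ := by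
  have h : ‖attachPhi n v‖ ^ 2 = ‖v‖ ^ 2 := by
    rw [attachPhi_eq, norm_smul, mul_pow, norm_junk_sq]
    have : ‖((1 / Real.sqrt 2 : ℝ) ^ n : ℂ)‖ ^ 2 = (1 / 2) ^ n := by
      rw [norm_pow, Complex.norm_real, ← pow_mul, mul_comm n 2, pow_mul]
      simp
    rw [this]
    simp
  exact (pow_left_inj₀ (norm_nonneg _) (norm_nonneg _) two_ne_zero).1 h

theorem attachPhi_sub (v w : HTensor H K) :
    attachPhi n v - attachPhi n w = attachPhi n (v - w) := by
  simp [attachPhi, ← smul_sub, Finset.sum_sub_distrib]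

theorem tmap_attachBoth (A : H →L[ℂ] H) (B : K →L[ℂ] K) (M N : Qubits n →L[ℂ] Qubits n)
    (q : Fin n → Fin 2) (v : HTensor H K) :
    tmap (tmap A M) (tmap B N) (attachBoth q v)
      = tmap (attach (M (ket q))) (attach (N (ket q))) (tmap A B v) :=
  tmap_tmap_attach ..

theorem tmap_attach_smul_left (c : ℂ) (x y : Qubits n) (w : HTensor H K) :
    tmap (attach (c • x)) (attach y) w = c • tmap (attach x) (attach y) w := by
  rw [attach_smul, tmap_smul_left]; rfl

theorem tmap_attach_smul_right (c : ℂ) (x y : Qubits n) (w : HTensor H K) :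
    tmap (attach x) (attach (c • y)) w = c • tmap (attach x) (attach y) w := by
  rw [attach_smul, tmap_smul_right]; rfl

/-- A Pauli operator on one half of a maximally entangled state can be moved to the other half. -/
theorem sum_attach_pauliAt (P : Pauli) (j : Fin n) (w : HTensor H K) :
    ∑ p : Fin n → Fin 2, tmap (attach (pauliAt P j (ket p))) (attach (ket p)) w
      = P.transposeSign •
        ∑ p : Fin n → Fin 2, tmap (attach (ket p)) (attach (pauliAt P j (ket p))) w := by
  let e : (Fin n → Fin 2) → (Fin n → Fin 2) := fun q => Function.update q j (P.act (q j))
  have he : Function.Involutive e := fun q => by simp [e]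
  have h1 : ∀ p, pauliAt P j (ket p) = P.phase (p j) • ket (e p) := fun p => pauliAt_ket P j p
  have h2 : ∀ p, pauliAt P j (ket (e p)) = (P.transposeSign * P.phase (p j)) • ket p := by
    intro p
    rw [h1, he p, ← P.phase_act]
    simp [e]
  -- Reindexing one sum by the bit flip `e` matches the kets on both sides; the phases then differ
  -- by the sign of transposition.
  rw [← he.bijective.sum_comp, Finset.smul_sum]
  refine Finset.sum_congr rfl fun p _ => ?_
  rw [h2, h1, tmap_attach_smul_left, tmap_attach_smul_right, smul_smul]

theorem tmap_attachPhi (A : H →L[ℂ] H) (B : K →L[ℂ] K) (M N : Qubits n →L[ℂ] Qubits n)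
    (v : HTensor H K) :
    tmap (tmap A M) (tmap B N) (attachPhi n v) = ((1 / Real.sqrt 2 : ℝ) ^ n : ℂ) •
      ∑ p, tmap (attach (M (ket p))) (attach (N (ket p))) (tmap A B v) := by
  simp only [attachPhi, map_smul, map_sum, tmap_attachBoth]

theorem tmap_pauliAt_attachPhi (A : H →L[ℂ] H) (B : K →L[ℂ] K) (P : Pauli) (j : Fin n)
    (v : HTensor H K) :
    tmap (tmap A (pauliAt P j)) (tmap B 1) (attachPhi n v)
      = P.transposeSign • tmap (tmap A 1) (tmap B (pauliAt P j)) (attachPhi n v) := by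
  rw [tmap_attachPhi, tmap_attachPhi]
  exact (congrArg _ (sum_attach_pauliAt P j (tmap A B v))).trans (smul_comm _ _ _)

theorem tmap_attachPhi_one (A : H →L[ℂ] H) (B : K →L[ℂ] K) (v : HTensor H K) :
    tmap (tmap A (1 : Qubits n →L[ℂ] Qubits n)) (tmap B (1 : Qubits n →L[ℂ] Qubits n))
      (attachPhi n v) = attachPhi n (tmap A B v) :=
  tmap_attachPhi A B 1 1 v

theorem tmap_junk_of_diagonal {M N : Qubits n →L[ℂ] Qubits n} {c d : (Fin n → Fin 2) → ℂ}
    (hM : ∀ q, M (ket q) = c q • ket q) (hN : ∀ q, N (ket q) = d q • ket q)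
    (ξ : (Fin n → Fin 2) → HTensor H K) :
    tmap (tmap 1 M) (tmap 1 N) (junk ξ) = junk fun q => (d q * c q) • ξ q := by
  simp only [junk, map_sum, tmap_attachBoth, hM, hN, tmap_attach_smul_left,
    tmap_attach_smul_right, tmap_one, smul_smul, one_apply_eq_self, map_smul]
  rfl

end Registers

/-! ### Operator inequalities on a tensor product -/

section Abstract

variable {H K : Type*} [NormedAddCommGroup H] [InnerProductSpace ℂ H]
  [NormedAddCommGroup K] [InnerProductSpace ℂ K]

theorem tmap_left_right (A : H →L[ℂ] H) (B : K →L[ℂ] K) (v : HTensor H K) :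
    tmap A 1 (tmap 1 B v) = tmap 1 B (tmap A 1 v) := by
  rw [tmap_tmap_apply, tmap_tmap_apply]; rfl

theorem tmap_mul_left (A A' : H →L[ℂ] H) (v : HTensor H K) :
    tmap (A * A') 1 v = tmap A (1 : K →L[ℂ] K) (tmap A' 1 v) := by
  rw [tmap_tmap_apply]; rfl

theorem tmap_mul_right (B B' : K →L[ℂ] K) (v : HTensor H K) :
    tmap 1 (B * B') v = tmap (1 : H →L[ℂ] H) B (tmap 1 B' v) := by
  rw [tmap_tmap_apply]; rfl

theorem norm_mul_le_one {A B : H →L[ℂ] H} (hA : ‖A‖ ≤ 1) (hB : ‖B‖ ≤ 1) : ‖A * B‖ ≤ 1 :=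
  (norm_mul_le A B).trans (mul_le_one₀ hA (norm_nonneg _) hB)

theorem tmap_neg_right (A : H →L[ℂ] H) (B : K →L[ℂ] K) : tmap A (-B) = -tmap A B := by
  simpa using tmap_smul_right (-1) A B

/-- If operators `A i` act on `φ` like `A' i` on a nearby vector `Ψ`, and the action of `A' i` on
`Ψ` can be moved to the other tensor factor, then products of the `A i` act on `φ` like products
of the `A' i` on `Ψ`, with an error linear in the number of factors. -/
theorem norm_prod_sub_prod_le {ι : Type*} {A A' : ι → H →L[ℂ] H} {B : ι → K →L[ℂ] K}
    {φ Ψ : HTensor H K} {δ : ℝ} (hA : ∀ i, ‖A i‖ ≤ 1) (hB : ∀ i, ‖B i‖ ≤ 1)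
    (h0 : ‖φ - Ψ‖ ≤ δ) (h1 : ∀ i, ‖tmap (A i) (1 : K →L[ℂ] K) φ - tmap (A' i) 1 Ψ‖ ≤ δ)
    (hT : ∀ i, tmap (A' i) (1 : K →L[ℂ] K) Ψ = tmap (1 : H →L[ℂ] H) (B i) Ψ) (J : List ι) :
    ‖tmap (J.map A).prod (1 : K →L[ℂ] K) φ - tmap (J.map A').prod 1 Ψ‖
      ≤ (2 * J.length + 1) * δ := by
  -- A product of ideal operators on Ψ equals one contraction `R` on the other factor, with the
  -- letters in reversed order.
  have hR : ∀ J : List ι, ∃ R : K →L[ℂ] K, ‖R‖ ≤ 1 ∧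
      tmap (J.map A').prod (1 : K →L[ℂ] K) Ψ = tmap (1 : H →L[ℂ] H) R Ψ := by
    intro J
    induction J with
    | nil => exact ⟨1, norm_one_le, by simp⟩
    | cons i J ih =>
      obtain ⟨R, hR, h⟩ := ih
      refine ⟨R * B i, norm_mul_le_one hR (hB i), ?_⟩
      rw [List.map_cons, List.prod_cons, tmap_mul_left, h, tmap_left_right, hT, tmap_mul_right]
  induction J with
  | nil => simpa using h0
  | cons i J ih =>
    obtain ⟨R, hR, h⟩ := hR J
    have hAi : ‖tmap (A i) (1 : K →L[ℂ] K)‖ ≤ 1 := norm_tmap_le_one (hA i) norm_one_le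
    have hR1 : ‖tmap (1 : H →L[ℂ] H) R‖ ≤ 1 := norm_tmap_le_one norm_one_le hR
    rw [List.map_cons, List.prod_cons, List.map_cons, List.prod_cons, tmap_mul_left,
      tmap_mul_left]
    -- One more factor costs 2δ: since `R` commutes with `A i` and `A' i`, only `A i` Ψ against `A'
    -- i` Ψ matters, and the detour through `A i` φ costs δ twice.
    have e1 := (norm_apply_sub_le hAi (tmap (J.map A).prod 1 φ)
      (tmap (J.map A').prod 1 Ψ)).trans ih
    have e2 := (norm_apply_sub_le hAi Ψ φ).trans ((norm_sub_rev _ _).trans_le h0)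
    have e3 := norm_apply_sub_le hR1 (tmap (A i) (1 : K →L[ℂ] K) Ψ) (tmap (A' i) 1 Ψ)
    have e4 := norm_sub_le_norm_sub_add_norm_sub (tmap (A i) (1 : K →L[ℂ] K) Ψ)
      (tmap (A i) 1 φ) (tmap (A' i) 1 Ψ)
    rw [← tmap_left_right, ← tmap_left_right, ← h] at e3
    have e5 := norm_sub_le_norm_sub_add_norm_sub
      (tmap (A i) (1 : K →L[ℂ] K) (tmap (J.map A).prod (1 : K →L[ℂ] K) φ))
      (tmap (A i) (1 : K →L[ℂ] K) (tmap (J.map A').prod (1 : K →L[ℂ] K) Ψ))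
      (tmap (A' i) 1 (tmap (J.map A').prod (1 : K →L[ℂ] K) Ψ))
    have e6 := h1 i
    push_cast [List.length_cons]
    linarith

/-- If contractions `A₁, A₂, A₃` act on `Ψ` like operators `V₁, V₂, V₃` on the other tensor factor
with `V₂ V₁ = - V₃`, then `A₁ A₂` acts approximately like `- A₃`. -/
theorem norm_mul_add_apply_le {A₁ A₂ A₃ : H →L[ℂ] H} {V₁ V₂ V₃ : K →L[ℂ] K} {Ψ : HTensor H K}
    {κ : ℝ} (hA : ‖A₁‖ ≤ 1) (hV : ‖V₂‖ ≤ 1) (hVV : V₂ * V₁ = -V₃)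
    (h₁ : ‖tmap A₁ (1 : K →L[ℂ] K) Ψ - tmap (1 : H →L[ℂ] H) V₁ Ψ‖ ≤ κ)
    (h₂ : ‖tmap A₂ (1 : K →L[ℂ] K) Ψ - tmap (1 : H →L[ℂ] H) V₂ Ψ‖ ≤ κ)
    (h₃ : ‖tmap A₃ (1 : K →L[ℂ] K) Ψ - tmap (1 : H →L[ℂ] H) V₃ Ψ‖ ≤ κ) :
    ‖tmap (A₁ * A₂) (1 : K →L[ℂ] K) Ψ + tmap A₃ (1 : K →L[ℂ] K) Ψ‖ ≤ 3 * κ := by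
  -- The chain is A₁A₂Ψ ≈ A₁V₂Ψ = V₂A₁Ψ ≈ V₂V₁Ψ = -V₃Ψ ≈ -A₃Ψ; passing to the other factor reverses
  -- the order, which is why `hVV` concerns V₂V₁.
  have e1 := (norm_apply_sub_le (norm_tmap_le_one (K := K) (K' := K) hA norm_one_le)
    (tmap A₂ 1 Ψ) (tmap 1 V₂ Ψ)).trans h₂
  have e2 := (norm_apply_sub_le (norm_tmap_le_one (H := H) (H' := H) norm_one_le hV)
    (tmap A₁ 1 Ψ) (tmap 1 V₁ Ψ)).trans h₁
  rw [← tmap_mul_left, tmap_left_right] at e1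
  rw [← tmap_mul_right, hVV, tmap_neg_right] at e2
  have : tmap (A₁ * A₂) (1 : K →L[ℂ] K) Ψ + tmap A₃ (1 : K →L[ℂ] K) Ψ
      = (tmap (A₁ * A₂) 1 Ψ - tmap 1 V₂ (tmap A₁ 1 Ψ))
        + (tmap 1 V₂ (tmap A₁ 1 Ψ) - (-tmap 1 V₃) Ψ) + (tmap A₃ 1 Ψ - tmap 1 V₃ Ψ) := by
    rw [neg_apply]; abel
  rw [this]
  refine norm_add₃_le.trans ?_
  linarith

/-- A contraction whose correlation with a projector is almost maximal acts almost like a sign on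
the range of that projector. -/
theorem norm_sub_smul_le [CompleteSpace K] {A : H →L[ℂ] H} {S : K →L[ℂ] K} {ψ : HTensor H K}
    {p η : ℝ} {σ : ℂ}
    (hA : ‖A‖ ≤ 1) (hS : IsStarProjection S) (hσ : σ = 1 ∨ σ = -1)
    (h0 : ‖expect ψ 1 S - p‖ ≤ η) (h1 : ‖expect ψ A S - σ * p‖ ≤ η) :
    ‖tmap A S ψ - σ • tmap (1 : H →L[ℂ] H) S ψ‖ ≤ 2 * Real.sqrt η := by
  have hη : 0 ≤ η := (norm_nonneg _).trans h0
  have hSS : ∀ x y, inner ℂ (S x) y = inner ℂ x (S y) := fun x y => by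
    have := ContinuousLinearMap.adjoint_inner_left S y x
    rw [← ContinuousLinearMap.star_eq_adjoint, hS.isSelfAdjoint.star_eq] at this
    exact this
  have hidem : S.comp S = S := hS.isIdempotentElem
  have hinner : ∀ B : H →L[ℂ] H, inner ℂ (tmap (1 : H →L[ℂ] H) S ψ) (tmap B S ψ)
      = expect ψ B S := by
    intro B
    rw [inner_tmap_left (A' := 1) (B' := S) (fun _ _ => rfl) hSS, tmap_tmap_apply, hidem]
    rfl
  set x := tmap (1 : H →L[ℂ] H) S ψ with hx
  set y := tmap A S ψ with hy
  have hyx : ‖y‖ ≤ ‖x‖ := by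
    have : y = tmap A 1 x := by rw [hx, tmap_tmap_apply]; rfl
    rw [this]
    exact norm_apply_le_of_contraction (norm_tmap_le_one hA norm_one_le) x
  have hxx : ‖x‖ ^ 2 ≤ p + η := by
    have h : (‖x‖ ^ 2 : ℝ) = (expect ψ 1 S).re := by
      rw [← hinner 1, ← hx, inner_self_eq_norm_sq_to_K]
      norm_cast
    have := (Complex.abs_re_le_norm _).trans h0
    simp only [Complex.sub_re, Complex.ofReal_re] at this
    rw [h]; linarith [(abs_le.1 this).2]
  have hxy : p - η ≤ (inner ℂ (σ • x) y).re := by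
    have h : (inner ℂ (σ • x) y).re - p = (σ * (expect ψ A S - σ * p)).re := by
      rw [inner_smul_left, hinner A]
      rcases hσ with rfl | rfl
      · simp
      · simp only [neg_one_mul, map_neg, map_one, Complex.neg_re, Complex.sub_re,
          Complex.ofReal_re]
        ring
    have h2 : ‖σ * (expect ψ A S - σ * p)‖ ≤ η := by
      rw [norm_mul]
      rcases hσ with rfl | rfl <;> simpa only [norm_neg, norm_one, one_mul] using h1
    have := (Complex.abs_re_le_norm _).trans h2
    rw [← h] at this
    linarith [(abs_le.1 this).1]
  have hσn : ‖σ • x‖ = ‖x‖ := by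
    rcases hσ with rfl | rfl <;> simp
  -- Expanding the square: ‖y‖² + ‖x‖² ≤ 2(p + η) and the cross term is at least 2(p - η), which
  -- leaves 4η.
  have hsq : ‖y - σ • x‖ ^ 2 ≤ (2 * Real.sqrt η) ^ 2 := by
    have h : ‖y - σ • x‖ ^ 2 = ‖y‖ ^ 2 - 2 * (inner ℂ (σ • x) y).re + ‖x‖ ^ 2 := by
      rw [norm_sub_rev, @norm_sub_sq ℂ, hσn]
      simp only [RCLike.re_eq_complex_re]; ring
    rw [h, mul_pow, Real.sq_sqrt hη]
    nlinarith [norm_nonneg y, norm_nonneg x]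
  exact (pow_le_pow_iff_left₀ (norm_nonneg _) (by positivity) two_ne_zero).1 hsq

end Abstract

/-! ### Projective measurements -/

namespace ProjMeas

variable {ι H : Type*} [Fintype ι] [NormedAddCommGroup H]
  [InnerProductSpace ℂ H] [CompleteSpace H]

/-- The operator `∑ a, u a • Π a` of a projective measurement `Π`. -/
def combine (M : ProjMeas ι H) (u : ι → ℂ) : H →L[ℂ] H := ∑ a, u a • M.proj a

/-- Orthogonality of the projectors makes `combine` multiplicative, so relations between outcome
signs become operator relations. -/
theorem combine_mul (M : ProjMeas ι H) (u v : ι → ℂ) :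
    M.combine u * M.combine v = M.combine fun a => u a * v a := by
  simp only [combine, Finset.sum_mul_sum]
  refine Finset.sum_congr rfl fun a _ => ?_
  rw [Finset.sum_eq_single a]
  · rw [smul_mul_smul_comm, (M.isProj a).isIdempotentElem.eq]
  · intro b _ hb
    rw [smul_mul_smul_comm, M.orth a b hb.symm, smul_zero]
  · simp

theorem star_combine (M : ProjMeas ι H) (u : ι → ℂ) :
    star (M.combine u) = M.combine (star u) := by
  simp [combine, star_sum, star_smul, (M.isProj _).isSelfAdjoint.star_eq]

theorem norm_combine_le (M : ProjMeas ι H) {u : ι → ℂ} (hu : ∀ a, star (u a) * u a = 1) :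
    ‖M.combine u‖ ≤ 1 := by
  refine norm_le_one_of_star_mul_self ?_
  rw [star_combine, combine_mul]
  simp only [combine, Pi.star_apply, hu, one_smul, M.sum_eq_one]

theorem combine_indicator_isStarProjection (M : ProjMeas ι H) (p : ι → Prop) [DecidablePred p] :
    IsStarProjection (M.combine fun a => if p a then 1 else 0) where
  isIdempotentElem := by
    rw [IsIdempotentElem, combine_mul]
    congr 1; ext a; simp
  isSelfAdjoint := by
    rw [IsSelfAdjoint, star_combine]
    congr 1; ext a; simp [apply_ite]

theorem sum_filter_eq_combine (M : ProjMeas ι H) (p : ι → Prop) [DecidablePred p] :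
    ∑ a with p a, M.proj a = M.combine fun a => if p a then 1 else 0 := by
  simp [combine, Finset.sum_filter]

theorem norm_bitObs_le {n : ℕ} (M : ProjMeas (Fin n → ℤˣ) H) (i : Fin n) : ‖M.bitObs i‖ ≤ 1 := by
  have : M.bitObs i = M.combine fun c => ((c i : ℤ) : ℂ) := by
    rw [bitObs, combine, Finset.sum_filter, Finset.sum_filter, ← Finset.sum_sub_distrib]
    refine Finset.sum_congr rfl fun c _ => ?_
    rcases Int.units_eq_one_or (c i) with h | h <;> simp [h]
  rw [this]
  refine M.norm_combine_le fun c => ?_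
  rcases Int.units_eq_one_or (c i) with h | h <;> simp [h]

theorem marginal_isStarProjection {k : ℕ} (M : ProjMeas (Fin k → Fin 4) H) (l : Fin k)
    (a : Fin 4) : IsStarProjection (M.marginal l a) := by
  rw [marginal, sum_filter_eq_combine]
  exact M.combine_indicator_isStarProjection _

theorem sum_smul_marginal {k : ℕ} (M : ProjMeas (Fin k → Fin 4) H) (l : Fin k)
    (u : Fin 4 → ℂ) : ∑ a, u a • M.marginal l a = M.combine fun b => u (b l) := by
  simp only [marginal, Finset.smul_sum, combine]
  simp only [Finset.sum_filter]
  rw [Finset.sum_comm]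
  simp

theorem sum_marginal {k : ℕ} (M : ProjMeas (Fin k → Fin 4) H) (l : Fin k) :
    ∑ a, M.marginal l a = 1 := by
  have := M.sum_smul_marginal l 1
  simpa [combine, M.sum_eq_one] using this

end ProjMeas

theorem norm_obsC_le {n : ℕ} {HC HA : Type*}
    [NormedAddCommGroup HC] [InnerProductSpace ℂ HC] [CompleteSpace HC]
    [NormedAddCommGroup HA] [InnerProductSpace ℂ HA] [CompleteSpace HA]
    (s : Strategy n HC HA) (P : Pauli) (i : Fin n) : ‖s.obsC P i‖ ≤ 1 := by
  -- An average of 3^(n-1) contractions: fixing one setting leaves the other n - 1 free.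
  have hcard : (Finset.univ.filter fun z : Fin n → Pauli => z i = P).card = 3 ^ (n - 1) := by
    have := Fintype.card_filter_piFinset_const (Finset.univ : Finset Pauli) i P
    simpa [show (Finset.univ : Finset Pauli).card = 3 from rfl] using this
  have hsum : ‖∑ z with z i = P, (s.measC z).bitObs i‖ ≤ 3 ^ (n - 1) := by
    refine (norm_sum_le_of_le (n := fun _ => 1) _
      fun z _ => (s.measC z).norm_bitObs_le i).trans ?_
    simp [hcard]
  rw [Strategy.obsC, norm_smul]
  have : ‖(1 : ℂ) / 3 ^ (n - 1)‖ = 1 / 3 ^ (n - 1) := by simp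
  rw [this, one_div, inv_mul_le_iff₀ (by positivity), mul_one]
  exact hsum

/-- Charlie's products on two sites act on the state like a signed sum of Alice's projectors, if
the correlations with the latter are almost ideal. -/
theorem norm_pair_sub_combine_le {k : ℕ} {HC HA : Type*}
    [NormedAddCommGroup HC] [InnerProductSpace ℂ HC]
    [NormedAddCommGroup HA] [InnerProductSpace ℂ HA] [CompleteSpace HA]
    (M : ProjMeas (Fin k → Fin 4) HA) (l : Fin k) {A : HC →L[ℂ] HC} {ψ : HTensor HC HA} {η : ℝ}
    (P : Pauli) (hA : ‖A‖ ≤ 1) (h0 : ∀ a, ‖expect ψ 1 (M.marginal l a) - 1 / 4‖ ≤ η)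
    (h1 : ∀ a, ‖expect ψ A (M.marginal l a) - bellSign P a / 4‖ ≤ η) :
    ‖tmap A (1 : HA →L[ℂ] HA) ψ
      - tmap (1 : HC →L[ℂ] HC) (M.combine fun b => bellSign P (b l)) ψ‖ ≤ 8 * Real.sqrt η := by
  have hσ : ∀ a, bellSign P a = 1 ∨ bellSign P a = -1 := by
    intro a; cases P <;> fin_cases a <;> simp [bellSign]
  have key : ∀ a, ‖tmap A (M.marginal l a) ψ
      - bellSign P a • tmap (1 : HC →L[ℂ] HC) (M.marginal l a) ψ‖
      ≤ 2 * Real.sqrt η := fun a =>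
    norm_sub_smul_le (p := 1 / 4) hA (M.marginal_isStarProjection l a) (hσ a)
      (by simpa using h0 a) (by simpa [div_eq_mul_inv] using h1 a)
  have e : tmap A (1 : HA →L[ℂ] HA) ψ
      - tmap (1 : HC →L[ℂ] HC) (M.combine fun b => bellSign P (b l)) ψ
      = ∑ a, (tmap A (M.marginal l a) ψ
        - bellSign P a • tmap (1 : HC →L[ℂ] HC) (M.marginal l a) ψ) := by
    rw [← M.sum_smul_marginal l, ← M.sum_marginal l, tmap_sum_right, tmap_sum_right,
      Finset.sum_sub_distrib]
    simp [tmap_smul_right]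
  rw [e]
  -- Four outcomes, each contributing 2√η.
  refine (norm_sum_le_of_le _ fun a _ => key a).trans ?_
  simp; linarith

/-! ### Operators in the laboratories -/

section Conj

variable {L M : Type*} [NormedAddCommGroup L] [InnerProductSpace ℂ L]
  [NormedAddCommGroup M] [InnerProductSpace ℂ M]

/-- The operator `U A U⁻¹`. -/
def conjOp (U : L ≃ₗᵢ[ℂ] L) (A : L →L[ℂ] L) : L →L[ℂ] L :=
  (U : L →L[ℂ] L) * A * (U.symm : L →L[ℂ] L)

theorem conjOp_apply (U : L ≃ₗᵢ[ℂ] L) (A : L →L[ℂ] L) (x : L) :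
    conjOp U A x = U (A (U.symm x)) := rfl

theorem norm_conjOp_le (U : L ≃ₗᵢ[ℂ] L) {A : L →L[ℂ] L} (hA : ‖A‖ ≤ 1) : ‖conjOp U A‖ ≤ 1 :=
  ContinuousLinearMap.opNorm_le_bound _ zero_le_one fun x => by
    rw [conjOp_apply, U.norm_map, one_mul, ← U.symm.norm_map x]
    exact norm_apply_le_of_contraction hA _

theorem conjOp_one (U : L ≃ₗᵢ[ℂ] L) : conjOp U 1 = 1 := by
  ext x; simp [conjOp_apply]

theorem conjOp_mul (U : L ≃ₗᵢ[ℂ] L) (A B : L →L[ℂ] L) :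
    conjOp U (A * B) = conjOp U A * conjOp U B := by
  ext x; simp [conjOp_apply]

theorem conjOp_neg (U : L ≃ₗᵢ[ℂ] L) (A : L →L[ℂ] L) : conjOp U (-A) = -conjOp U A := by
  ext x; simp [conjOp_apply]

theorem conjOp_comp (U : L ≃ₗᵢ[ℂ] L) (A : L →L[ℂ] L) :
    (U : L →L[ℂ] L).comp A = (conjOp U A).comp (U : L →L[ℂ] L) := by
  ext x; simp [conjOp_apply]

theorem tmap_conjOp (U : L ≃ₗᵢ[ℂ] L) (V : M ≃ₗᵢ[ℂ] M) (A : L →L[ℂ] L) (B : M →L[ℂ] M)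
    (v : HTensor L M) :
    tmap (U : L →L[ℂ] L) (V : M →L[ℂ] M) (tmap A B v)
      = tmap (conjOp U A) (conjOp V B) (tmap (U : L →L[ℂ] L) (V : M →L[ℂ] M) v) := by
  rw [tmap_tmap_apply, tmap_tmap_apply, conjOp_comp, conjOp_comp]

theorem tmap_mul_apply (A A' : L →L[ℂ] L) (B B' : M →L[ℂ] M) (v : HTensor L M) :
    tmap (A * A') (B * B') v = tmap A B (tmap A' B' v) := by
  rw [← tmap_mul]; rfl

theorem tmap_smul_right_apply (c : ℂ) (A : L →L[ℂ] L) (B : M →L[ℂ] M) (v : HTensor L M) :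
    tmap A (c • B) v = c • tmap A B v := by
  rw [tmap_smul_right]; rfl

theorem norm_smul_le_one {c : ℂ} {A : L →L[ℂ] L} (hc : ‖c‖ = 1) (hA : ‖A‖ ≤ 1) :
    ‖c • A‖ ≤ 1 := by
  rwa [norm_smul, hc, one_mul]

end Conj

/-! ### Lifting to the laboratories and moving ideal observables to Alice -/

section Lab

variable {n : ℕ} {H K : Type*} [NormedAddCommGroup H] [InnerProductSpace ℂ H]
  [NormedAddCommGroup K] [InnerProductSpace ℂ K]

/-- The operator `A ⊗ 1 ⊗ 1` on the laboratory `H ⊗ H'' ⊗ H'`. -/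
def liftLab (n : ℕ) (A : H →L[ℂ] H) : Lab n H →L[ℂ] Lab n H := tmap (tmap A 1) 1

theorem norm_liftLab_le {A : H →L[ℂ] H} (hA : ‖A‖ ≤ 1) : ‖liftLab n A‖ ≤ 1 :=
  norm_tmap_le_one (norm_tmap_le_one hA norm_one_le) norm_one_le

theorem liftLab_one : liftLab n (1 : H →L[ℂ] H) = 1 := by
  rw [liftLab, tmap_one, tmap_one]

theorem liftLab_mul (A B : H →L[ℂ] H) : liftLab n (A * B) = liftLab n A * liftLab n B := by
  rw [liftLab, liftLab, liftLab, tmap_mul, tmap_mul]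
  rfl

theorem liftLab_neg (A : H →L[ℂ] H) : liftLab n (-A) = -liftLab n A := by
  rw [liftLab, liftLab, ← neg_one_smul ℂ A, tmap_smul_left, tmap_smul_left, neg_one_smul]

/-- The operator `U (A ⊗ 1 ⊗ 1) U⁻¹` on the laboratory `H ⊗ H'' ⊗ H'`. -/
def conjLab (U : Lab n H ≃ₗᵢ[ℂ] Lab n H) (A : H →L[ℂ] H) : Lab n H →L[ℂ] Lab n H :=
  conjOp U (liftLab n A)

theorem norm_conjLab_le (U : Lab n H ≃ₗᵢ[ℂ] Lab n H) {A : H →L[ℂ] H} (hA : ‖A‖ ≤ 1) :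
    ‖conjLab U A‖ ≤ 1 :=
  norm_conjOp_le U (norm_liftLab_le hA)

theorem conjLab_one (U : Lab n H ≃ₗᵢ[ℂ] Lab n H) : conjLab U 1 = 1 :=
  (congrArg (conjOp U) liftLab_one).trans (conjOp_one U)

theorem conjLab_mul (U : Lab n H ≃ₗᵢ[ℂ] Lab n H) (A B : H →L[ℂ] H) :
    conjLab U (A * B) = conjLab U A * conjLab U B :=
  (congrArg (conjOp U) (liftLab_mul A B)).trans (conjOp_mul U _ _)

theorem conjLab_neg (U : Lab n H ≃ₗᵢ[ℂ] Lab n H) (A : H →L[ℂ] H) :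
    conjLab U (-A) = -conjLab U A :=
  (congrArg (conjOp U) (liftLab_neg A)).trans (conjOp_neg U _)

theorem conjLab_list_prod {ι : Type*} (U : Lab n H ≃ₗᵢ[ℂ] Lab n H) (f : ι → H →L[ℂ] H)
    (J : List ι) : conjLab U (J.map f).prod = (J.map fun i => conjLab U (f i)).prod := by
  induction J with
  | nil => exact conjLab_one U
  | cons i J ih =>
    rw [List.map_cons, List.prod_cons, conjLab_mul, ih, List.map_cons, List.prod_cons]

theorem attachBoth_tmap (A : H →L[ℂ] H) (B : K →L[ℂ] K) (q : Fin n → Fin 2)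
    (v : HTensor H K) :
    attachBoth q (tmap A B v) = tmap (tmap A 1) (tmap B 1) (attachBoth q v) :=
  (tmap_attachBoth A B 1 1 q v).symm

theorem attachZero_tmap (A : H →L[ℂ] H) (B : K →L[ℂ] K) (v : HTensor H K) :
    attachZero n (tmap A B v) = tmap (liftLab n A) (liftLab n B) (attachZero n v) :=
  (congrArg (attachBoth 0) (attachBoth_tmap A B 0 v)).trans
    (attachBoth_tmap (tmap A 1) (tmap B 1) 0 (attachBoth 0 v))

theorem Extraction.run_tmap (E : Extraction n H K) (A : H →L[ℂ] H) (B : K →L[ℂ] K)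
    (v : HTensor H K) :
    E.run (tmap A B v) = tmap (conjLab E.UC A) (conjLab E.UA B) (E.run v) :=
  (congrArg (tmap (E.UC : Lab n H →L[ℂ] Lab n H) (E.UA : Lab n K →L[ℂ] Lab n K))
    (attachZero_tmap A B v)).trans
    (tmap_conjOp E.UC E.UA (liftLab n A) (liftLab n B) (attachZero n v))

theorem norm_idealObs_le (P : Pauli) (j : Fin n) : ‖idealObs (H := H) P j‖ ≤ 1 := by
  refine norm_tmap_le_one ?_ (norm_pauliAt_le P j)
  split_ifs
  · exact norm_tmap_le_one norm_one_le (norm_pauliAt_le _ j)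
  · exact norm_one_le

theorem idealObs_mul_self (P : Pauli) (j : Fin n) :
    idealObs (H := H) P j * idealObs P j = 1 := by
  rw [idealObs, tmap_mul, pauliAt_mul_self]
  split_ifs
  · rw [tmap_mul, pauliAt_mul_self, mul_one, tmap_one, tmap_one]
  · rw [mul_one, tmap_one]

/-- The product of the two ideal `Y` observables carries an extra σ_z ⊗ σ_z on the junk register; as
this squares to 1, multiplying by it once more recovers the bare σ_y ⊗ σ_y. -/
theorem idealObs_ZZXX {j k : Fin n} (hjk : j ≠ k) :
    idealObs (H := H) .Z j * idealObs .Z k * (idealObs .X j * idealObs .X k)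
      = -(idealObs .Y j * idealObs .Y k
          * tmap (tmap 1 (pauliAt .Z j * pauliAt .Z k)) 1) := by
  have hZ : Pauli.Z ≠ Pauli.Y := by decide
  have hX : Pauli.X ≠ Pauli.Y := by decide
  simp only [idealObs, if_neg hZ, if_neg hX, if_true, tmap_mul, mul_one, pauliAt_ZZXX hjk,
    pauliAt_Z_mul_sq, tmap_one, tmap_neg_right]

/-- The operator on Alice's side with the same action as `idealObs P j` on the ideal state. -/
def transposedObs (P : Pauli) (j : Fin n) : Lab n K →L[ℂ] Lab n K :=
  P.transposeSign • idealObs P j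

theorem norm_transposedObs_le (P : Pauli) (j : Fin n) : ‖transposedObs (K := K) P j‖ ≤ 1 :=
  norm_smul_le_one P.norm_transposeSign (norm_idealObs_le P j)

/-- The action of `idealObs P j` on the second register. -/
def sideObs (P : Pauli) (j : Fin n) : Qubits n →L[ℂ] Qubits n :=
  if P = .Y then pauliAt .Z j else 1

theorem idealObs_eq (P : Pauli) (j : Fin n) :
    idealObs (H := H) P j = tmap (tmap 1 (sideObs P j)) (pauliAt P j) := by
  by_cases h : P = .Y
  · simp only [idealObs, sideObs, if_pos h]
  · simp only [idealObs, sideObs, if_neg h, tmap_one]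

theorem sideObs_ket (P : Pauli) (j : Fin n) (q : Fin n → Fin 2) :
    sideObs P j (ket q) = (if P = .Y then Pauli.phase .Z (q j) else 1) • ket q := by
  by_cases h : P = .Y
  · simp only [sideObs, if_pos h, pauliAt_Z_ket]
  · simp only [sideObs, if_neg h, one_smul, one_apply_eq_self]

theorem one_apply_ket (q : Fin n → Fin 2) :
    (1 : Qubits n →L[ℂ] Qubits n) (ket q) = (1 : ℂ) • ket q := by
  simp

/-- Both junk registers hold the same string q, so a diagonal operator has the same effect on either
one. -/
theorem tmap_sideObs_junk (P : Pauli) (j : Fin n) (ξ : (Fin n → Fin 2) → HTensor H K) :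
    tmap (tmap (1 : H →L[ℂ] H) (sideObs P j)) (tmap (1 : K →L[ℂ] K) 1) (junk ξ)
      = tmap (tmap (1 : H →L[ℂ] H) 1) (tmap (1 : K →L[ℂ] K) (sideObs P j)) (junk ξ) := by
  rw [tmap_junk_of_diagonal (sideObs_ket P j) one_apply_ket,
    tmap_junk_of_diagonal one_apply_ket (sideObs_ket P j)]
  simp only [mul_one, one_mul]

/-- A tensor product of an operator that can be moved to the other side of `w` and a Pauli operator
can be moved to the other side of `w ⊗ Φ`. -/
theorem tmap_attachPhi_transpose {S : H →L[ℂ] H} {T : K →L[ℂ] K} {w : HTensor H K}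
    (h : tmap S 1 w = tmap 1 T w) (P : Pauli) (j : Fin n) :
    tmap (tmap S (pauliAt P j)) (1 : HTensor K (Qubits n) →L[ℂ] HTensor K (Qubits n))
        (attachPhi n w)
      = tmap (1 : HTensor H (Qubits n) →L[ℂ] HTensor H (Qubits n))
        (P.transposeSign • tmap T (pauliAt P j)) (attachPhi n w) := by
  have h1 := tmap_pauliAt_attachPhi S (1 : K →L[ℂ] K) P j w
  have h2 := tmap_mul_apply (1 : HTensor H (Qubits n) →L[ℂ] HTensor H (Qubits n)) (tmap S 1)
    (tmap (1 : K →L[ℂ] K) (pauliAt P j)) (tmap 1 1) (attachPhi n w)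
  have h3 := tmap_mul_apply (1 : HTensor H (Qubits n) →L[ℂ] HTensor H (Qubits n)) (tmap 1 1)
    (tmap (1 : K →L[ℂ] K) (pauliAt P j)) (tmap T 1) (attachPhi n w)
  rw [tmap_attachPhi_one, tmap_mul] at h2 h3
  rw [h, ← h3] at h2
  simp only [one_mul, mul_one, tmap_one] at h1 h2
  exact h1.trans ((congrArg (P.transposeSign • ·) h2).trans
    (tmap_smul_right_apply _ _ _ _).symm)

theorem tmap_idealObs_attachPhi_junk (P : Pauli) (j : Fin n)
    (ξ : (Fin n → Fin 2) → HTensor H K) :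
    tmap (idealObs (H := H) P j) (1 : Lab n K →L[ℂ] Lab n K) (attachPhi n (junk ξ))
      = tmap (1 : Lab n H →L[ℂ] Lab n H) (transposedObs (K := K) P j)
          (attachPhi n (junk ξ)) := by
  have h := tmap_sideObs_junk P j ξ
  rw [tmap_one, tmap_one] at h
  have h' := tmap_attachPhi_transpose h P j
  have e := idealObs_eq (H := H) P j
  have e' : transposedObs (K := K) P j = _ :=
    congrArg (P.transposeSign • ·) (idealObs_eq (H := K) P j)
  exact (congrArg (fun T => tmap T (1 : Lab n K →L[ℂ] Lab n K) (attachPhi n (junk ξ))) e).trans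
    (h'.trans (congrArg (fun T => tmap (1 : Lab n H →L[ℂ] Lab n H) T (attachPhi n (junk ξ)))
      e').symm)

end Lab

/-! ### Alignment of the junk state -/

section Alignment

variable {n : ℕ} {H K : Type*} [NormedAddCommGroup H] [InnerProductSpace ℂ H]
  [NormedAddCommGroup K] [InnerProductSpace ℂ K]

theorem tmap_attachPhi_left (A : H →L[ℂ] H) (v : HTensor H K) :
    tmap (tmap A (1 : Qubits n →L[ℂ] Qubits n))
      (1 : HTensor K (Qubits n) →L[ℂ] HTensor K (Qubits n)) (attachPhi n v)
      = attachPhi n (tmap A 1 v) := by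
  have h := tmap_attachPhi_one (n := n) A (1 : K →L[ℂ] K) v
  rwa [tmap_one] at h

theorem tmap_ZZ_junk (j k : Fin n) (ξ : (Fin n → Fin 2) → HTensor H K) :
    tmap (tmap 1 (pauliAt .Z j * pauliAt .Z k)) (1 : HTensor K (Qubits n) →L[ℂ] _) (junk ξ)
      = junk fun q => (if q j = q k then (1 : ℂ) else -1) • ξ q := by
  have h := tmap_junk_of_diagonal (pauliAt_Z_mul_ket j k) one_apply_ket ξ
  rw [tmap_one] at h
  simpa only [one_mul] using h

/-- The product of the parities `σ_z` of two sites on the second register detects the misaligned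
part of the junk state. -/
theorem norm_sub_ZZ_sq (j k : Fin n) (ξ : (Fin n → Fin 2) → HTensor H K) :
    ‖attachPhi n (junk ξ) - tmap (tmap (tmap 1 (pauliAt .Z j * pauliAt .Z k)) 1)
        (1 : Lab n K →L[ℂ] Lab n K) (attachPhi n (junk ξ))‖ ^ 2
      = 4 * ∑ q with q j ≠ q k, ‖ξ q‖ ^ 2 := by
  have h := tmap_attachPhi_left (n := n) (tmap (1 : H →L[ℂ] H) (pauliAt .Z j * pauliAt .Z k))
    (junk ξ)
  refine (congrArg (fun v => ‖attachPhi n (junk ξ) - v‖ ^ 2) h).trans ?_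
  rw [attachPhi_sub, norm_attachPhi, tmap_ZZ_junk, junk_sub, norm_junk_sq, Finset.sum_filter,
    Finset.mul_sum]
  refine Finset.sum_congr rfl fun q _ => ?_
  by_cases hq : q j = q k
  · simp [hq]
  · rw [if_neg hq, if_pos hq, neg_one_smul, sub_neg_eq_add, ← two_smul ℂ, norm_smul, mul_pow]
    norm_num

theorem eq_const_of_adjacent {q : Fin n → Fin 2}
    (h : ∀ i : Fin (n - 1), q ⟨i, by omega⟩ = q ⟨i + 1, by omega⟩) :
    (q = fun _ => 0) ∨ (q = fun _ => 1) := by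
  rcases Nat.eq_zero_or_pos n with rfl | hn
  · exact Or.inl (Subsingleton.elim _ _)
  have hc : ∀ i (hi : i < n), q ⟨i, hi⟩ = q ⟨0, hn⟩ := by
    intro i
    induction i with
    | zero => intro _; rfl
    | succ i ih => intro hi; rw [← ih (by omega)]; exact (h ⟨i, by omega⟩).symm
  have hb : ∀ b : Fin 2, b = 0 ∨ b = 1 := by decide
  exact (hb (q ⟨0, hn⟩)).imp (fun h0 => funext fun i => (hc i i.2).trans h0)
    (fun h0 => funext fun i => (hc i i.2).trans h0)

/-- A union bound: each nonconstant string is counted at least once on the right, at a pair where it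
changes. -/
theorem norm_junk_sub_alignedJunk_sq_le (hn : 1 ≤ n) (ξ : (Fin n → Fin 2) → HTensor H K) :
    ‖junk ξ - alignedJunk ξ‖ ^ 2
      ≤ ∑ i : Fin (n - 1), ∑ q : Fin n → Fin 2
          with q ⟨i, by omega⟩ ≠ q ⟨i + 1, by omega⟩, ‖ξ q‖ ^ 2 := by
  rw [alignedJunk_eq_junk hn, junk_sub, norm_junk_sq]
  simp only [Finset.sum_filter]
  rw [Finset.sum_comm]
  refine Finset.sum_le_sum fun q _ => ?_
  by_cases hq : (q = fun _ => 0) ∨ (q = fun _ => 1)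
  · rw [if_pos hq, sub_self, norm_zero]
    exact (by norm_num : (0 : ℝ) ^ 2 ≤ 0).trans
      (Finset.sum_nonneg fun i _ => by split_ifs <;> positivity)
  · have : ∃ i : Fin (n - 1), q ⟨i, by omega⟩ ≠ q ⟨i + 1, by omega⟩ := by
      by_contra! h
      exact hq (eq_const_of_adjacent h)
    obtain ⟨i, hi⟩ := this
    rw [if_neg hq, sub_zero]
    refine le_trans (by rw [if_pos hi]) (Finset.single_le_sum
      (f := fun i : Fin (n - 1) => if q ⟨i, by omega⟩ ≠ q ⟨i + 1, by omega⟩ then ‖ξ q‖ ^ 2 else 0)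
      (fun i _ => by split_ifs <;> positivity) (Finset.mem_univ i))

theorem norm_junk_sub_alignedJunk_le (hn : 1 ≤ n) (ξ : (Fin n → Fin 2) → HTensor H K) {κ : ℝ}
    (hκ : 0 ≤ κ)
    (h : ∀ i : Fin (n - 1), ‖attachPhi n (junk ξ) - tmap (tmap (tmap 1
        (pauliAt .Z ⟨i, by omega⟩ * pauliAt .Z ⟨i + 1, by omega⟩)) 1)
        (1 : Lab n K →L[ℂ] Lab n K) (attachPhi n (junk ξ))‖ ≤ 2 * κ) :
    ‖junk ξ - alignedJunk ξ‖ ≤ Real.sqrt n * κ := by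
  have h1 : ‖junk ξ - alignedJunk ξ‖ ^ 2 ≤ n * κ ^ 2 := by
    refine (norm_junk_sub_alignedJunk_sq_le hn ξ).trans ?_
    refine (Finset.sum_le_card_nsmul _ _ (κ ^ 2) fun i _ => ?_).trans ?_
    -- The 4 in `norm_sub_ZZ_sq` cancels the square of the 2 in the hypothesis, so each pair has
    -- weight at most κ².
    · have h2 := pow_le_pow_left₀ (norm_nonneg _) (h i) 2
      rw [norm_sub_ZZ_sq] at h2
      linarith
    · rw [Finset.card_univ, Fintype.card_fin, nsmul_eq_mul]
      have : ((n - 1 : ℕ) : ℝ) ≤ n := by exact_mod_cast Nat.sub_le n 1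
      nlinarith [sq_nonneg κ]
  refine (pow_le_pow_iff_left₀ (norm_nonneg _) (by positivity) two_ne_zero).1 ?_
  rwa [mul_pow, Real.sq_sqrt (Nat.cast_nonneg n)]

/-- Applying the contraction Y₂Y₁, which inverts Y₁Y₂, turns AΨ + Y₁Y₂Ψ into Ψ - DΨ. -/
theorem norm_sub_le_of_mul_involutions {Y₁ Y₂ D A : H →L[ℂ] H} (hA : A = -(Y₁ * Y₂ * D))
    (h₁ : Y₁ * Y₁ = 1) (h₂ : Y₂ * Y₂ = 1) (n₁ : ‖Y₁‖ ≤ 1) (n₂ : ‖Y₂‖ ≤ 1) (Ψ : HTensor H K) :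
    ‖Ψ - tmap D (1 : K →L[ℂ] K) Ψ‖
      ≤ ‖tmap A (1 : K →L[ℂ] K) Ψ + tmap (Y₁ * Y₂) (1 : K →L[ℂ] K) Ψ‖ := by
  have hY : (Y₂ * Y₁) * (Y₁ * Y₂) = 1 := by
    rw [mul_assoc, ← mul_assoc Y₁, h₁, one_mul, h₂]
  have hA' : tmap A (1 : K →L[ℂ] K) = -tmap (Y₁ * Y₂ * D) 1 := by
    rw [hA, ← neg_one_smul ℂ (Y₁ * Y₂ * D), tmap_smul_left, neg_one_smul]
  have h : Ψ - tmap D (1 : K →L[ℂ] K) Ψ = tmap (Y₂ * Y₁) (1 : K →L[ℂ] K)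
      (tmap A (1 : K →L[ℂ] K) Ψ + tmap (Y₁ * Y₂) (1 : K →L[ℂ] K) Ψ) := by
    rw [map_add, hA', neg_apply, map_neg, ← tmap_mul_left, ← tmap_mul_left, ← mul_assoc, hY,
      one_mul, tmap_one, one_apply_eq_self]
    abel
  rw [h]
  exact norm_apply_le_of_contraction (norm_tmap_le_one (norm_mul_le_one n₂ n₁) norm_one_le) _

theorem norm_attachBoth (q : Fin n → Fin 2) (v : HTensor H K) : ‖attachBoth q v‖ = ‖v‖ := by
  have h := inner_attachBoth q q v v
  rw [if_pos rfl, inner_self_eq_norm_sq_to_K, inner_self_eq_norm_sq_to_K] at h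
  have h' : ‖attachBoth q v‖ ^ 2 = ‖v‖ ^ 2 := Complex.ofReal_injective (by push_cast; exact h)
  exact (pow_left_inj₀ (norm_nonneg _) (norm_nonneg _) two_ne_zero).1 h'

theorem attachZero_sub (v w : HTensor H K) :
    attachZero n v - attachZero n w = attachZero n (v - w) :=
  ((congrArg (attachBoth 0) ((attachBoth (n := n) 0).map_sub v w)).trans
    ((attachBoth (n := n) 0).map_sub (attachBoth 0 v) (attachBoth 0 w))).symm

theorem Extraction.norm_run_sub_run_le (E : Extraction n H K) (v w : HTensor H K) :
    ‖E.run v - E.run w‖ ≤ ‖v - w‖ := by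
  refine (norm_apply_sub_le (norm_tmap_le_one ?_ ?_) (attachZero n v) (attachZero n w)).trans ?_
  · exact ContinuousLinearMap.opNorm_le_bound _ zero_le_one fun x => by simp
  · exact ContinuousLinearMap.opNorm_le_bound _ zero_le_one fun x => by simp
  · rw [attachZero_sub]
    exact ((norm_attachBoth 0 (attachBoth 0 (v - w))).trans (norm_attachBoth 0 (v - w))).le

theorem Extraction.run_left (E : Extraction n H K) (A : H →L[ℂ] H) (v : HTensor H K) :
    E.run (tmap A 1 v) = tmap (conjLab E.UC A) (1 : Lab n K →L[ℂ] Lab n K) (E.run v) :=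
  (E.run_tmap A 1 v).trans
    (congrArg (fun T => tmap (conjLab E.UC A) T (E.run v)) (conjLab_one E.UA))

theorem Extraction.run_right (E : Extraction n H K) (B : K →L[ℂ] K) (v : HTensor H K) :
    E.run (tmap 1 B v) = tmap (1 : Lab n H →L[ℂ] Lab n H) (conjLab E.UA B) (E.run v) :=
  (E.run_tmap 1 B v).trans
    (congrArg (fun T => tmap T (conjLab E.UA B) (E.run v)) (conjLab_one E.UC))

theorem norm_list_prod_le_one (P : Pauli) (J : List (Fin n)) :
    ‖(J.map (idealObs (H := H) P)).prod‖ ≤ 1 := by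
  induction J with
  | nil => exact norm_one_le
  | cons j J ih =>
    rw [List.map_cons, List.prod_cons]
    exact norm_mul_le_one (norm_idealObs_le P j) ih

end Alignment

/-! ### Products of observables under an extraction -/

section SelfTest

variable {n : ℕ} {HC HA : Type*}
  [NormedAddCommGroup HC] [InnerProductSpace ℂ HC] [CompleteSpace HC]
  [NormedAddCommGroup HA] [InnerProductSpace ℂ HA] [CompleteSpace HA]
  {E : Extraction n HC HA} {s : Strategy n HC HA} {δ : ℝ}

set_option maxHeartbeats 2000000 in
theorem Extraction.SelfTests.norm_prod_le (hE : E.SelfTests s δ) (P : Pauli) (J : List (Fin n)) :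
    ‖E.run (tmap (J.map (s.obsC P)).prod (1 : HA →L[ℂ] HA) s.ψ)
      - tmap (J.map (idealObs (H := HC) P)).prod (1 : Lab n HA →L[ℂ] Lab n HA)
          (attachPhi n (junk E.ξ))‖ ≤ (2 * J.length + 1) * δ := by
  have h1 : ∀ j, ‖tmap (conjLab E.UC (s.obsC P j)) (1 : Lab n HA →L[ℂ] Lab n HA) (E.run s.ψ)
      - tmap (idealObs (H := HC) P j) (1 : Lab n HA →L[ℂ] Lab n HA)
        (attachPhi n (junk E.ξ))‖ ≤ δ := by
    intro j
    have := hE.2 P j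
    rwa [E.run_left] at this
  have h := norm_prod_sub_prod_le (fun j => norm_conjLab_le E.UC (norm_obsC_le s P j))
    (fun j => norm_transposedObs_le (K := HA) P j) hE.1 h1
    (fun j => tmap_idealObs_attachPhi_junk P j E.ξ) J
  rw [E.run_left, conjLab_list_prod]
  exact h

set_option maxHeartbeats 2000000 in
/-- If Charlie's products on two sites act on the state like operators `W P` of Alice with the
algebra of Bell-state signs, then the junk state is almost aligned on these sites. -/
theorem Extraction.SelfTests.norm_sub_ZZ_le (hE : E.SelfTests s δ) {j k : Fin n} (hjk : j ≠ k)
    {W : Pauli → HA →L[ℂ] HA} {τ : ℝ} (hW : ∀ P, ‖W P‖ ≤ 1) (hWW : W .X * W .Z = -W .Y)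
    (hτ : ∀ P, ‖tmap (s.obsC P j * s.obsC P k) 1 s.ψ - tmap 1 (W P) s.ψ‖ ≤ τ) :
    ‖attachPhi n (junk E.ξ) - tmap (tmap (tmap 1 (pauliAt .Z j * pauliAt .Z k)) 1)
        (1 : Lab n HA →L[ℂ] Lab n HA) (attachPhi n (junk E.ξ))‖ ≤ 3 * (τ + 6 * δ) := by
  have hP : ∀ P, ‖tmap (idealObs (H := HC) P j * idealObs P k) (1 : Lab n HA →L[ℂ] Lab n HA)
      (attachPhi n (junk E.ξ)) - tmap (1 : Lab n HC →L[ℂ] Lab n HC) (conjLab E.UA (W P))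
      (attachPhi n (junk E.ξ))‖ ≤ τ + 6 * δ := by
    intro P
    -- The two-factor product costs 5δ; replacing U[ψ ⊗ 00] by the ideal state under Alice's
    -- operator costs one more δ.
    have e1 := hE.norm_prod_le P [j, k]
    simp only [List.map_cons, List.map_nil, List.prod_cons, List.prod_nil, mul_one,
      List.length_cons, List.length_nil] at e1
    have e2 := (E.norm_run_sub_run_le _ _).trans (hτ P)
    rw [E.run_right] at e2
    have e3 := (norm_apply_sub_le (norm_tmap_le_one (H := Lab n HC) (H' := Lab n HC) norm_one_le
      (norm_conjLab_le E.UA (hW P))) (E.run s.ψ) (attachPhi n (junk E.ξ))).trans hE.1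
    rw [norm_sub_rev] at e1
    have e4 := norm_sub_le_norm_sub_add_norm_sub
      (tmap (idealObs (H := HC) P j * idealObs P k) (1 : Lab n HA →L[ℂ] Lab n HA)
        (attachPhi n (junk E.ξ))) (E.run (tmap (s.obsC P j * s.obsC P k) 1 s.ψ))
      (tmap (1 : Lab n HC →L[ℂ] Lab n HC) (conjLab E.UA (W P)) (E.run s.ψ))
    have e5 := norm_sub_le_norm_sub_add_norm_sub
      (tmap (idealObs (H := HC) P j * idealObs P k) (1 : Lab n HA →L[ℂ] Lab n HA)
        (attachPhi n (junk E.ξ)))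
      (tmap (1 : Lab n HC →L[ℂ] Lab n HC) (conjLab E.UA (W P)) (E.run s.ψ))
      (tmap (1 : Lab n HC →L[ℂ] Lab n HC) (conjLab E.UA (W P)) (attachPhi n (junk E.ξ)))
    push_cast at e1
    linarith
  have hV : conjLab E.UA (W .X) * conjLab E.UA (W .Z) = -conjLab E.UA (W .Y) :=
    (conjLab_mul E.UA _ _).symm.trans ((congrArg (conjLab E.UA) hWW).trans (conjLab_neg _ _))
  have h := norm_mul_add_apply_le
    (norm_mul_le_one (norm_idealObs_le .Z j) (norm_idealObs_le .Z k))
    (norm_conjLab_le E.UA (hW .X)) hV (hP .Z) (hP .X) (hP .Y)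
  exact (norm_sub_le_of_mul_involutions (idealObs_ZZXX hjk) (idealObs_mul_self .Y j)
    (idealObs_mul_self .Y k) (norm_idealObs_le .Y j) (norm_idealObs_le .Y k) _).trans h

theorem Extraction.SelfTests.norm_sub_ZZ_le_of_correlations (hE : E.SelfTests s δ) {j k : Fin n}
    (hjk : j ≠ k) {m : ℕ} (M : ProjMeas (Fin m → Fin 4) HA) (l : Fin m) {η : ℝ}
    (h : ∀ a, ‖expect s.ψ 1 (M.marginal l a) - 1 / 4‖ ≤ η ∧ ∀ P,
      ‖expect s.ψ (s.obsC P j * s.obsC P k) (M.marginal l a) - bellSign P a / 4‖ ≤ η) :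
    ‖attachPhi n (junk E.ξ) - tmap (tmap (tmap 1 (pauliAt .Z j * pauliAt .Z k)) 1)
        (1 : Lab n HA →L[ℂ] Lab n HA) (attachPhi n (junk E.ξ))‖
      ≤ 3 * (8 * Real.sqrt η + 6 * δ) := by
  refine hE.norm_sub_ZZ_le hjk (W := fun P => M.combine fun b => bellSign P (b l))
    (fun P => M.norm_combine_le fun b => ?_) ?_ fun P =>
      norm_pair_sub_combine_le M l P (norm_mul_le_one (norm_obsC_le s P j) (norm_obsC_le s P k))
        (fun a => (h a).1) fun a => (h a).2 P
  · generalize b l = a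
    cases P <;> fin_cases a <;> simp [bellSign]
  -- The Bell-state identity s_X s_Z = -s_Y, outcome by outcome.
  · have : ∀ a, bellSign .X a * bellSign .Z a = -bellSign .Y a := by
      intro a; fin_cases a <;> simp [bellSign]
    simp only [ProjMeas.combine_mul, this]
    simp [ProjMeas.combine]

theorem Extraction.SelfTests.norm_junk_sub_alignedJunk_le (hn : 1 ≤ n) (hE : E.SelfTests s δ)
    {b : BellMeasurements n HA} {η : ℝ} (hb : TableWithin s b η) :
    ‖junk E.ξ - alignedJunk E.ξ‖ ≤ 12 * (Real.sqrt n * (Real.sqrt η + δ)) := by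
  have hδ : 0 ≤ δ := (norm_nonneg _).trans hE.1
  have hη := Real.sqrt_nonneg η
  refine (ParallelPauli.norm_junk_sub_alignedJunk_le hn E.ξ (κ := 12 * (Real.sqrt η + δ))
    (by positivity) fun i => ?_).trans (by linarith)
  refine le_trans ?_ (by linarith : 3 * (8 * Real.sqrt η + 6 * δ) ≤ 2 * (12 * (Real.sqrt η + δ)))
  have hi := i.2
  -- With sites numbered from 0, `lozenge` covers the pairs starting at even sites and
  -- `blackLozenge` those starting at odd sites; together they link the whole chain.
  rcases Nat.even_or_odd' i.1 with ⟨l, hl | hl⟩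
  · have := hE.norm_sub_ZZ_le_of_correlations (by simp) b.lozenge ⟨l, by omega⟩
      (hb.1 ⟨l, by omega⟩)
    simpa only [hl] using this
  · have := hE.norm_sub_ZZ_le_of_correlations (by simp) b.blackLozenge ⟨l, by omega⟩
      (hb.2 ⟨l, by omega⟩)
    simpa only [hl] using this

set_option maxHeartbeats 2000000 in
theorem Extraction.SelfTests.norm_prod_sub_aligned_le (hE : E.SelfTests s δ) (P : Pauli)
    (J : List (Fin n)) :
    ‖E.run (tmap (J.map (s.obsC P)).prod (1 : HA →L[ℂ] HA) s.ψ)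
      - tmap (J.map (idealObs (H := HC) P)).prod (1 : Lab n HA →L[ℂ] Lab n HA)
          (attachPhi n (alignedJunk E.ξ))‖
      ≤ (2 * J.length + 1) * δ + ‖junk E.ξ - alignedJunk E.ξ‖ := by
  have h := norm_apply_sub_le (norm_tmap_le_one (norm_list_prod_le_one P J)
    (norm_one_le (H := Lab n HA))) (attachPhi n (junk E.ξ)) (attachPhi n (alignedJunk E.ξ))
  rw [attachPhi_sub, norm_attachPhi] at h
  exact (norm_sub_le_norm_sub_add_norm_sub _ _ _).trans (add_le_add (hE.norm_prod_le P J) h)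

end SelfTest

end ParallelPauli

end

/-! ### Robust alignment with an absolute constant -/

theorem mainTheorem6 :
    ∃ K : ℝ, 0 < K ∧
      ∀ (n : ℕ), 1 ≤ n →
      ∀ (HC HA : Type*)
        [NormedAddCommGroup HC] [InnerProductSpace ℂ HC] [CompleteSpace HC]
        [NormedAddCommGroup HA] [InnerProductSpace ℂ HA] [CompleteSpace HA]
        (C m ε₀ : ℝ), 0 ≤ C → 0 < m → 0 < ε₀ →
        RobustParallelSelfTest n HC HA C m ε₀ →
        ∀ (ε η : ℝ), 0 ≤ ε → ε ≤ ε₀ → 0 ≤ η →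
        ∀ (s : Strategy n HC HA) (b : BellMeasurements n HA),
          (∀ i, 6 * Real.sqrt 2 - ε ≤ s.bellValue i) →
          TableWithin s b η →
          (∃ E : Extraction n HC HA, E.SelfTests s (C * ε ^ m)) ∧
          ∀ E : Extraction n HC HA, E.SelfTests s (C * ε ^ m) →
            ‖junk E.ξ - alignedJunk E.ξ‖
                ≤ K * (Real.sqrt n * (Real.sqrt η + C * ε ^ m)) ∧
            ∀ (P : Pauli) (J : List (Fin n)), J.Nodup →
              ‖E.run (tmap (J.map (s.obsC P)).prod 1 s.ψ)
                  - tmap (J.map (idealObs P)).prod 1 (attachPhi n (alignedJunk E.ξ))‖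
                ≤ K * (Real.sqrt n * (Real.sqrt η + C * ε ^ m) + J.length * (C * ε ^ m)) := by
  -- Alignment uses 12. In (2k + 1)δ the single δ is absorbed by one more √n(√η + δ), as √n ≥ 1, and
  -- 2kδ ≤ 13kδ.
  refine ⟨13, by norm_num, ?_⟩
  intro n hn HC HA _ _ _ _ _ _ C m ε₀ hC hm hε₀ hR ε η hε hε' hη s b hs hb
  refine ⟨hR ε hε hε' s hs, fun E hE => ?_⟩
  have hδ : 0 ≤ C * ε ^ m := mul_nonneg hC (Real.rpow_nonneg hε m)
  have hη' := Real.sqrt_nonneg η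
  have hn' : 1 ≤ Real.sqrt n := Real.one_le_sqrt.2 (by exact_mod_cast hn)
  have h := hE.norm_junk_sub_alignedJunk_le hn hb
  have h0 : C * ε ^ m ≤ Real.sqrt n * (Real.sqrt η + C * ε ^ m) := by nlinarith
  refine ⟨by linarith, fun P J _ => (hE.norm_prod_sub_aligned_le P J).trans ?_⟩
  have hJ : 0 ≤ (J.length : ℝ) * (C * ε ^ m) := by positivity
  linarith
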